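/- Let $X$ be a set. A game tree on $X$ is a nonempty set $T$ of finite sequences from $X$ closed under initial segments; its elements are called positions, and a position is terminal if it has no proper extension in $T$. Let $[T]$ be the set of infinite sequences all of whose finite initial segments lie in $T$, and let the set of plays $\lceil T\rceil$ consist of the terminal positions together with $[T]$. For $p\in T$ let $T_p$ be the game tree of all $q\in T$ comparable with $p$. Equip $\lceil T\rceil$ with the topology with basic open sets $\lceil T_p\rceil$ ($p\in T$), and $[T]$ with the subspace topology. For $W\subseteq\lceil T\rceil$, in the game $G(W;T)$ players I and II alternately extend a position, starting from the empty one with I moving first; player I wins a play $x\in\lceil T\rceil$ if $x\in W$, and II wins it otherwise. A strategy for I (resp. II) assigns to each nonterminal position $p\in T$ of even (resp. odd) length some $a\in X$ with $p^\frown\langle a\rangle\in T$. A play is consistent with a strategy if each of that player's moves in it is the one given by the strategy. A strategy is winning if its player wins every play consistent with it, and the game is determined if one of the players has a winning strategy. A game tree with taboos $\mathbf T=\langle T,\mathcal T_{\mathrm I},\mathcal T_{\mathrm{II}}\rangle$ consists of a game tree $T$ and disjoint (possibly empty) sets $\mathcal T_{\mathrm I},\mathcal T_{\mathrm{II}}$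 with union $\lceil T\rceil\setminus[T]$. For $A\subseteq[T]$, let $G(A;\mathbf T)$ be the game $G(A\cup\mathcal T_{\mathrm{II}};T)$. **Corollary (Borel Determinacy).** 1. For every game tree with taboos $\mathbf T$ on $X$ and every Borel set $A\subseteq[T]$, the game $G(A;\mathbf T)$ is determined. 2. For every pruned game tree $T$ on $X$ (one with no terminal positions, so that $\lceil T\rceil=[T]$) and every Borel set $A\subseteq[T]$, the game $G(A;T)$ is determined. -/

import Mathlib

universe u

namespace TabooGame

open Descriptive

variable {X : Type u}

/-- Sequences of length at most `ω`: a finite sequence (`Sum.inl`) or an infinite one (`Sum.inr`). -/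
abbrev FinOrInfSeq (X : Type u) : Type u := List X ⊕ (ℕ → X)

/-- `IsInitSeg p x`: the finite sequence `p` is an initial segment of `x`. -/
def IsInitSeg (p : List X) : FinOrInfSeq X → Prop
  | Sum.inl q => p <+: q
  | Sum.inr x => ∀ (k : ℕ) (hk : k < p.length), p[k] = x k

/-- A position is terminal if it has no proper extension in the tree. -/
def IsTerminal (T : tree X) (p : List X) : Prop :=
  p ∈ T ∧ ¬ ∃ q ∈ T, p <+: q ∧ p ≠ q

/-- A tree is pruned if it has no terminal positions. -/
def IsPruned (T : tree X) : Prop := ∀ p, ¬ IsTerminal T p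

/-- A play is a terminal position, or an infinite branch all of whose finite
initial segments are in the tree. -/
def IsPlay (T : tree X) : FinOrInfSeq X → Prop
  | Sum.inl p => IsTerminal T p
  | Sum.inr x => ∀ p : List X, IsInitSeg p (Sum.inr x) → p ∈ T

/-- The set of all plays, finite and infinite, as a type. -/
def Play (T : tree X) : Type u := {x : FinOrInfSeq X // IsPlay T x}

/-- The game subtree at `p`: all positions comparable with `p`. -/
def subtree (T : tree X) (p : List X) : tree X :=
  ⟨{q | q ∈ T ∧ (q <+: p ∨ p <+: q)}, by
    rintro q a ⟨hq, h⟩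
    refine ⟨Tree.mem_of_append hq, ?_⟩
    rcases h with h | h
    · exact Or.inl ((List.prefix_append q [a]).trans h)
    · exact List.prefix_or_prefix_of_prefix (List.prefix_append q [a]) h⟩

/-- The topology on plays generated by the sets of plays of the game subtrees. -/
instance (T : tree X) : TopologicalSpace (Play T) :=
  TopologicalSpace.generateFrom
    {U | ∃ p ∈ T, U = {x : Play T | IsPlay (subtree T p) x.1}}

/-- The set of infinite plays; as a type it carries the subspace topology. -/
def infinitePlays (T : tree X) : Set (Play T) := {x | ∃ b : ℕ → X, x.1 = Sum.inr b}

/-- A set is Borel if it lies in the σ-algebra generated by the open sets. -/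
def IsBorel {Y : Type u} [TopologicalSpace Y] (A : Set Y) : Prop := @MeasurableSet Y (borel Y) A

inductive Player : Type
  | I
  | II

/-- Player I moves at positions of even length, player II at positions of odd length. -/
def Player.ToMove : Player → ℕ → Prop
  | Player.I, n => Even n
  | Player.II, n => Odd n

/-- The nonterminal positions at which the given player has to move. -/
abbrev MovePosition (T : tree X) (P : Player) : Type u :=
  {p : List X // p ∈ T ∧ ¬ IsTerminal T p ∧ P.ToMove p.length}

/-- A strategy chooses a legal move at each nonterminal position where the player has to move. -/
def Strategy (T : tree X) (P : Player) : Type u :=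
  ∀ p : MovePosition T P, {a : X // p.1 ++ [a] ∈ T}

/-- A position `p` is consistent with `σ` if each entry of `p` that is a move of the player is
the one chosen by `σ` at the initial segment `q` of `p` before it. -/
def Strategy.ConsistentPos {T : tree X} {P : Player} (σ : Strategy T P) (p : List X) : Prop :=
  ∀ (q : MovePosition T P) (a : X), q.1 ++ [a] <+: p → a = (σ q).1

/-- A play is consistent with `σ` if all positions that are initial segments of it are. -/
def Strategy.ConsistentPlay {T : tree X} {P : Player} (σ : Strategy T P) (x : Play T) : Prop :=
  ∀ p ∈ T, IsInitSeg p x.1 → σ.ConsistentPos p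

/-- The game `G(A; T)`, in which I wins a play iff it is in `A`, is determined:
I or II has a winning strategy. -/
def Determined (T : tree X) (A : Set (Play T)) : Prop :=
  (∃ σ : Strategy T Player.I, ∀ x : Play T, σ.ConsistentPlay x → x ∈ A) ∨
  (∃ τ : Strategy T Player.II, ∀ x : Play T, τ.ConsistentPlay x → x ∉ A)

end TabooGame

/-- A game tree with taboos: a nonempty tree whose finite plays are divided into those
taboo for I and those taboo for II (either part may be empty). -/
structure TabooGame.TabooTree (X : Type u) where
  tree : Descriptive.tree X
  nonempty : (tree : Set (List X)).Nonempty
  tabooI : Set (TabooGame.Play tree)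
  tabooII : Set (TabooGame.Play tree)
  disjoint : Disjoint tabooI tabooII
  union_eq : tabooI ∪ tabooII = (TabooGame.infinitePlays tree)ᶜ

/-- The plays won by player I in the game with taboos `G(A; T)`: those in `A` and those taboo
for II. -/
def TabooGame.TabooTree.payoff {X : Type u} (T : TabooGame.TabooTree X)
    (A : Set (TabooGame.infinitePlays T.tree)) : Set (TabooGame.Play T.tree) :=
  Subtype.val '' A ∪ T.tabooII

/-!
The proof follows Martin's inductive proof of Borel determinacy, with game trees presented as
*arenas*: every position has a successor, and a taboo is a mark saying which player has lost,
carried by all later positions as well. So all plays are infinite, and finite plays of the given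
tree are continued by idle moves (`TabooGame.treeArena`).

A *covering* (`Arena.Cover`) of an arena `A` by an arena `B` is a map from `B` to `A` together with
a transfer of strategies from `B` to `A`, such that each play `x` by a transferred strategy is
shadowed by a play by the original one: a play lying over `x`, unless and until the owner of the
strategy loses it by a taboo. Winning strategies are therefore transferred to winning strategies,
and it suffices to find a covering in which the payoff set becomes clopen, clopen games being
determined (`Arena.IsClopenOn.winsFrom`).

An open set is made clopen by one auxiliary exchange (`Arena.exists_cover_of_isOpenOn`). Together
with some move, player `P` announces a set `Y` of positions at which play might enter the open set;
the opponent then either challenges one of them, and from then on both must play towards it, or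
accepts, and then `P` loses on reaching an entrance outside `Y`, the opponent on reaching one
in `Y`. Thus, taboos aside, the open set is reached if and only if there has been a challenge. A
strategy of `P` is transferred by pretending that the opponent has accepted until an entrance `u` in
`Y` is reached, and that `u` has been challenged from then on; this is consistent, since moves
towards a challenged position are forced. A strategy of the opponent is transferred by pretending
that `Y` is the set of positions never challenged, whatever is announced; this `Y` must be
accepted, and if an entrance outside it is reached, there is an announcement in reply to which it
would have been challenged.

Coverings that are isomorphisms up to ever greater lengths have inverse limits
(`Arena.limitCover`), because transferred strategies depend on the original ones locally. So
countably many sets can be made clopen simultaneously; their union is then open, and can be made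
clopen by one more covering (`Arena.Unravellable.iUnion`). Hence all Borel sets can be made clopen
(`TabooGame.unravellable_encode`).
-/

namespace TabooGame

/-! ### Arenas -/

/-- The opponent of a player. -/
def Player.other : Player → Player
  | Player.I => Player.II
  | Player.II => Player.I

@[simp] theorem Player.other_other (i : Player) : i.other.other = i := by cases i <;> rfl

theorem Player.other_ne (i : Player) : i.other ≠ i := by cases i <;> simp [Player.other]

theorem Player.eq_or_eq_other (i j : Player) : j = i ∨ j = i.other := by
  cases i <;> cases j <;> simp [Player.other]

theorem Player.toMove_other (i : Player) (n : ℕ) : i.other.ToMove n ↔ ¬ i.ToMove n := by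
  cases i <;> simp [Player.other, Player.ToMove]

theorem Player.toMove_succ (i : Player) (n : ℕ) : i.ToMove (n + 1) ↔ i.other.ToMove n := by
  cases i <;> simp [Player.other, Player.ToMove, parity_simps]

theorem Player.exists_toMove (n : ℕ) : ∃ i : Player, i.ToMove n := by
  rcases Nat.even_or_odd n with h | h
  exacts [⟨Player.I, h⟩, ⟨Player.II, h⟩]

/-- A game tree without terminal positions, given by its positions, their lengths `lvl` and the
map `par` deleting the last move. Taboos are encoded by `status`: it names the player, if any, who
has lost by now; play goes on formally after such a loss, which is final. Several positions may
have length `0`; the value of `par` there is irrelevant. -/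
structure Arena : Type (u + 1) where
  Pos : Type u
  lvl : Pos → ℕ
  par : Pos → Pos
  status : Pos → Option Player
  lvl_par : ∀ p, lvl (par p) = lvl p - 1
  exists_child : ∀ p, ∃ q, lvl q = lvl p + 1 ∧ par q = p
  status_par : ∀ p i, status (par p) = some i → status p = some i

namespace Arena

section Basic

variable (A : Arena.{u})

/-- `q` extends `p` by one move. -/
def IsChild (q p : A.Pos) : Prop := A.lvl q = A.lvl p + 1 ∧ A.par q = p

/-- A choice of a move at every position. As a strategy for one of the players, only its values at
the positions where that player moves matter. -/
structure Strat where
  toFun : A.Pos → A.Pos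
  isChild : ∀ p, A.IsChild (toFun p) p

instance : CoeFun A.Strat (fun _ => A.Pos → A.Pos) := ⟨Strat.toFun⟩

instance : Nonempty A.Strat :=
  ⟨⟨fun p => (A.exists_child p).choose, fun p => (A.exists_child p).choose_spec⟩⟩

/-- An infinite play, as the sequence of its positions. -/
structure IsBranch (x : ℕ → A.Pos) : Prop where
  lvl_zero : A.lvl (x 0) = 0
  isChild : ∀ n, A.IsChild (x (n + 1)) (x n)

/-- An infinite play in which no player has run into a taboo. -/
structure IsAlive (x : ℕ → A.Pos) : Prop extends A.IsBranch x where
  status : ∀ n, A.status (x n) = none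

/-- The sequence `x` follows the strategy `s` of player `i` from length `N` on. -/
def FollowsFrom (i : Player) (s : A.Strat) (N : ℕ) (x : ℕ → A.Pos) : Prop :=
  ∀ n, N ≤ n → i.ToMove n → x (n + 1) = s (x n)

variable {A}

theorem IsBranch.lvl_eq {x : ℕ → A.Pos} (hx : A.IsBranch x) (n : ℕ) : A.lvl (x n) = n := by
  induction n with
  | zero => exact hx.lvl_zero
  | succ n ih => rw [(hx.isChild n).1, ih]

theorem IsBranch.iterate_par {x : ℕ → A.Pos} (hx : A.IsBranch x) (n j : ℕ) :
    A.par^[j] (x (n + j)) = x n := by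
  induction j with
  | zero => rfl
  | succ j ih => rw [Function.iterate_succ_apply, ← add_assoc, (hx.isChild _).2, ih]

theorem IsBranch.eq_of_le {x y : ℕ → A.Pos} (hx : A.IsBranch x) (hy : A.IsBranch y) {m n : ℕ}
    (h : x n = y n) (hmn : m ≤ n) : x m = y m := by
  obtain ⟨j, rfl⟩ := Nat.exists_eq_add_of_le hmn
  rw [← hx.iterate_par, h, hy.iterate_par]

theorem IsBranch.status_of_le {x : ℕ → A.Pos} (hx : A.IsBranch x) {m n : ℕ} {i : Player}
    (h : A.status (x m) = some i) (hmn : m ≤ n) : A.status (x n) = some i := by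
  induction n, hmn using Nat.le_induction with
  | base => exact h
  | succ n _ ih => exact A.status_par _ _ (by rw [(hx.isChild n).2, ih])

/-- A finite play can be continued by a strategy for both players. -/
theorem exists_branch_extending {z : ℕ → A.Pos} {N : ℕ} (h0 : A.lvl (z 0) = 0)
    (hz : ∀ n, n < N → A.IsChild (z (n + 1)) (z n)) (s : A.Strat) :
    ∃ y, A.IsBranch y ∧ (∀ n ≤ N, y n = z n) ∧ ∀ n, N ≤ n → y (n + 1) = s (y n) := by
  have h1 : ∀ n, N ≤ n →
      (if n + 1 ≤ N then z (n + 1) else s^[n + 1 - N] (z N)) =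
        s (if n ≤ N then z n else s^[n - N] (z N)) := by
    intro n hn
    rw [if_neg (by omega), Nat.succ_sub hn, Function.iterate_succ_apply']
    split_ifs with h
    · obtain rfl : n = N := by omega
      simp
    · rfl
  refine ⟨fun n => if n ≤ N then z n else s^[n - N] (z N), ⟨by simpa using h0, fun n => ?_⟩,
    fun n hn => if_pos hn, h1⟩
  rcases lt_or_ge n N with hn | hn
  · simp only [if_pos hn.le, if_pos (Nat.succ_le_of_lt hn)]
    exact hz n hn
  · rw [h1 n hn]
    exact s.isChild _

theorem lvl_iterate_par (p : A.Pos) (j : ℕ) : A.lvl (A.par^[j] p) = A.lvl p - j := by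
  induction j with
  | zero => rfl
  | succ j ih => rw [Function.iterate_succ_apply', A.lvl_par, ih]; omega

/-- Every position lies on a branch. -/
theorem exists_branch_through (p : A.Pos) : ∃ x, A.IsBranch x ∧ x (A.lvl p) = p := by
  obtain ⟨s⟩ := (inferInstance : Nonempty A.Strat)
  obtain ⟨y, hy, hyp, -⟩ := exists_branch_extending (A := A) (N := A.lvl p)
    (z := fun n => A.par^[A.lvl p - n] p) (by simp [lvl_iterate_par])
    (fun n hn => ⟨by simp only [lvl_iterate_par]; omega, by
      rw [← Function.iterate_succ_apply' (f := A.par)]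
      congr 1; omega⟩) s
  exact ⟨y, hy, by simpa using hyp _ le_rfl⟩

end Basic

/-! ### Coverings -/

/-- A map of arenas preserving lengths and initial segments. It may forget taboos but creates
none. -/
structure Hom (B A : Arena.{u}) where
  toFun : B.Pos → A.Pos
  lvl_toFun : ∀ b, A.lvl (toFun b) = B.lvl b
  par_toFun : ∀ b, A.par (toFun b) = toFun (B.par b)
  alive : ∀ b, B.status b = none → A.status (toFun b) = none

theorem Hom.map_isChild {B A : Arena.{u}} (f : Hom B A) {b c : B.Pos} (h : B.IsChild b c) :
    A.IsChild (f.toFun b) (f.toFun c) :=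
  ⟨by rw [f.lvl_toFun, f.lvl_toFun, h.1], by rw [f.par_toFun, h.2]⟩

theorem Hom.map_isBranch {B A : Arena.{u}} (f : Hom B A) {x : ℕ → B.Pos} (h : B.IsBranch x) :
    A.IsBranch (fun n => f.toFun (x n)) :=
  ⟨by rw [f.lvl_toFun, h.lvl_zero], fun n => f.map_isChild (h.isChild n)⟩

theorem Hom.map_isAlive {B A : Arena.{u}} (f : Hom B A) {x : ℕ → B.Pos} (h : B.IsAlive x) :
    A.IsAlive (fun n => f.toFun (x n)) :=
  ⟨f.map_isBranch h.toIsBranch, fun n => f.alive _ (h.status n)⟩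

/-- The identity map of an arena. -/
def Hom.id (A : Arena.{u}) : Hom A A := ⟨fun a => a, fun _ => rfl, fun _ => rfl, fun _ h => h⟩

/-- The composite of two maps of arenas. -/
def Hom.comp {C B A : Arena.{u}} (f : Hom B A) (g : Hom C B) : Hom C A where
  toFun c := f.toFun (g.toFun c)
  lvl_toFun c := by rw [f.lvl_toFun, g.lvl_toFun]
  par_toFun c := by rw [f.par_toFun, g.par_toFun]
  alive c h := f.alive _ (g.alive _ h)

/-- A `k`-covering of the arena `A` by the arena `B`: a map that is an isomorphism up to length
`k`, with a transfer of strategies from `B` to `A` such that moves up to a given length depend only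
on the given strategy up to that length. Every play `x` by a transferred strategy is shadowed by a
play `y` by the given strategy: `y` lies over `x`, with the same taboos, unless and until the owner
of the strategy loses `y` by a taboo. -/
structure Cover (k : ℕ) (B A : Arena.{u}) extends Hom B A where
  inj : ∀ b b', B.lvl b ≤ k → B.lvl b' ≤ k → toFun b = toFun b' → b = b'
  surj : ∀ a, A.lvl a ≤ k → ∃ b, toFun b = a
  status_eq : ∀ b, B.lvl b ≤ k → B.status b = A.status (toFun b)
  strat : Player → B.Strat → A.Strat
  strat_low : ∀ i s b, B.lvl b < k → strat i s (toFun b) = toFun (s b)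
  strat_local : ∀ i (s s' : B.Strat) n, (∀ b, B.lvl b ≤ n → s b = s' b) →
    ∀ a, A.lvl a ≤ n → strat i s a = strat i s' a
  lift : ∀ i s x, A.IsBranch x → A.FollowsFrom i (strat i s) 0 x →
    ∃ y, B.IsBranch y ∧ B.FollowsFrom i s 0 y ∧
      ∀ n, B.status (y n) = some i ∨ (toFun (y n) = x n ∧ B.status (y n) = A.status (x n))

/-- The composite of two coverings. -/
def Cover.comp {k : ℕ} {C B A : Arena.{u}} (c : Cover k B A) (d : Cover k C B) : Cover k C A where
  toHom := c.toHom.comp d.toHom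
  inj b b' h h' e := d.inj b b' h h' (c.inj _ _ (by rwa [d.lvl_toFun]) (by rwa [d.lvl_toFun]) e)
  surj a h := by
    obtain ⟨b, rfl⟩ := c.surj a h
    obtain ⟨e, rfl⟩ := d.surj b (by rwa [← c.lvl_toFun])
    exact ⟨e, rfl⟩
  status_eq b h := by
    rw [d.status_eq b h, c.status_eq _ (by rwa [d.lvl_toFun])]; rfl
  strat i s := c.strat i (d.strat i s)
  strat_low i s b h := by
    change c.strat i _ (c.toFun (d.toFun b)) = c.toFun (d.toFun (s b))
    rw [c.strat_low _ _ _ (by rwa [d.lvl_toFun]), d.strat_low _ _ _ h]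
  strat_local i s s' n h := c.strat_local i _ _ n (d.strat_local i _ _ n h)
  lift i s x hx hs := by
    obtain ⟨y, hy, hys, hyx⟩ := c.lift i _ x hx hs
    obtain ⟨z, hz, hzs, hzy⟩ := d.lift i s y hy hys
    refine ⟨z, hz, hzs, fun n => ?_⟩
    rcases hzy n with h | ⟨h1, h2⟩
    · exact Or.inl h
    · rcases hyx n with h' | ⟨h1', h2'⟩
      · exact Or.inl (h2.trans h')
      · exact Or.inr ⟨(congrArg c.toFun h1).trans h1', h2.trans h2'⟩

/-! ### Inverse limits of coverings -/

section Limit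

variable {A : ℕ → Arena.{u}} {K : ℕ → ℕ}

/-- In a sequence of coverings that are isomorphisms up to increasing lengths, a position of the
`M`-th arena in the range of the isomorphisms belongs to a coherent sequence of positions. -/
theorem exists_thread (hK : Monotone K) (c : ∀ m, Cover (K m) (A (m + 1)) (A m)) (M : ℕ)
    (q : (A M).Pos) (hq : (A M).lvl q ≤ K M) :
    ∃ f : ∀ m, (A m).Pos, (∀ m, (c m).toFun (f (m + 1)) = f m) ∧ f M = q := by
  induction M generalizing A K with
  | zero =>
    have step : ∀ m, ∀ p : {p : (A m).Pos // (A m).lvl p ≤ K m},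
        ∃ p' : {p : (A (m + 1)).Pos // (A (m + 1)).lvl p ≤ K (m + 1)},
          (c m).toFun p'.1 = p.1 := by
      rintro m ⟨p, hp⟩
      obtain ⟨b, rfl⟩ := (c m).surj p hp
      rw [(c m).lvl_toFun] at hp
      exact ⟨⟨b, hp.trans (hK m.le_succ)⟩, rfl⟩
    choose g hg using step
    let f : ∀ m, {p : (A m).Pos // (A m).lvl p ≤ K m} :=
      fun m => Nat.rec ⟨q, hq⟩ (fun m p => g m p) m
    exact ⟨fun m => (f m).1, fun m => hg m (f m), rfl⟩
  | succ M ih =>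
    obtain ⟨f, hf, rfl⟩ := ih (A := fun m => A (m + 1)) (K := fun m => K (m + 1))
      (fun a b h => hK (Nat.succ_le_succ h)) (fun m => c (m + 1)) q hq
    refine ⟨fun m => Nat.casesOn m ((c 0).toFun (f 0)) f, fun m => ?_, rfl⟩
    cases m with
    | zero => rfl
    | succ m => exact hf m

variable (c : ∀ m, Cover (K m) (A (m + 1)) (A m))

/-- The coherent sequences of positions in a sequence of coverings. -/
@[ext]
structure Thread : Type u where
  seq : ∀ m, (A m).Pos
  map_seq : ∀ m, (c m).toFun (seq (m + 1)) = seq m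

variable {c}

theorem Thread.lvl_eq (f : Thread c) (m : ℕ) : (A m).lvl (f.seq m) = (A 0).lvl (f.seq 0) := by
  induction m with
  | zero => rfl
  | succ m ih => rw [← ih, ← f.map_seq m, (c m).lvl_toFun]

theorem Thread.eq_of_apply_eq (hK : Monotone K) {f g : Thread c} {M : ℕ}
    (hf : (A M).lvl (f.seq M) ≤ K M) (h : f.seq M = g.seq M) : f = g := by
  refine Thread.ext (funext fun m => ?_)
  rcases le_total m M with hm | hm
  · induction hm using Nat.decreasingInduction with
    | self => exact h
    | of_succ m _ ih => rw [← f.map_seq, ← g.map_seq, ih]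
  · induction m, hm using Nat.le_induction with
    | base => exact h
    | succ m hm ih =>
      have h1 : (A (m + 1)).lvl (f.seq (m + 1)) ≤ K m := by
        rw [f.lvl_eq, ← f.lvl_eq M]; exact hf.trans (hK hm)
      have h2 : (A (m + 1)).lvl (g.seq (m + 1)) ≤ K m := by
        rw [g.lvl_eq, ← g.lvl_eq M, ← h]; exact hf.trans (hK hm)
      exact (c m).inj _ _ h1 h2 (by rw [f.map_seq, g.map_seq, ih])

theorem Thread.status_eq_of_le (hK : Monotone K) (f : Thread c) {M m : ℕ}
    (hf : (A 0).lvl (f.seq 0) ≤ K M) (h : M ≤ m) :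
    (A m).status (f.seq m) = (A M).status (f.seq M) := by
  induction m, h using Nat.le_induction with
  | base => rfl
  | succ m hm ih =>
    rw [(c m).status_eq _ (by rw [f.lvl_eq]; exact hf.trans (hK hm)), f.map_seq, ih]

theorem Thread.alive_of_le (f : Thread c) {M m : ℕ} (h : M ≤ m)
    (hm : (A m).status (f.seq m) = none) : (A M).status (f.seq M) = none := by
  induction m, h using Nat.le_induction with
  | base => exact hm
  | succ m _ ih => exact ih (by rw [← f.map_seq]; exact (c m).alive _ hm)

variable (c) in
/-- The inverse limit of a sequence of coverings that are isomorphisms up to increasing lengths.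
The status of a position is read off far enough out in the sequence, where it is constant. -/
def limit (hK : Monotone K) (hK' : ∀ m, m ≤ K m) : Arena.{u} where
  Pos := Thread c
  lvl f := (A 0).lvl (f.seq 0)
  par f := ⟨fun m => (A m).par (f.seq m), fun m => by rw [← (c m).par_toFun, f.map_seq]⟩
  status f := (A ((A 0).lvl (f.seq 0))).status (f.seq ((A 0).lvl (f.seq 0)))
  lvl_par f := (A 0).lvl_par _
  exists_child f := by
    obtain ⟨q, hq, hqf⟩ := (A _).exists_child (f.seq ((A 0).lvl (f.seq 0) + 1))
    replace hq := hq.trans (congrArg (· + 1) (f.lvl_eq _))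
    obtain ⟨g, hg, rfl⟩ := exists_thread hK c _ q (by rw [hq]; exact hK' _)
    have hg0 := Thread.lvl_eq (c := c) ⟨g, hg⟩ ((A 0).lvl (f.seq 0) + 1)
    refine ⟨⟨g, hg⟩, hg0.symm.trans hq,
      Thread.eq_of_apply_eq hK (M := (A 0).lvl (f.seq 0) + 1) ?_ hqf⟩
    refine le_trans ?_ (hK' _)
    change (A _).lvl ((A _).par _) ≤ _
    rw [(A _).lvl_par, hq]; omega
  status_par f i h := by
    refine (A _).status_par _ i ?_
    let f' : Thread c :=
      ⟨fun m => (A m).par (f.seq m), fun m => by rw [← (c m).par_toFun, f.map_seq]⟩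
    rw [← h]
    exact f'.status_eq_of_le hK (hK' _) (((A 0).lvl_par _).trans_le (Nat.sub_le _ _))

variable (hK : Monotone K) (hK' : ∀ m, m ≤ K m)

theorem limit_lvl (f : Thread c) (m : ℕ) :
    (A m).lvl (f.seq m) = (limit c hK hK').lvl f := f.lvl_eq m

theorem limit_status (f : Thread c) {m : ℕ} (hm : (limit c hK hK').lvl f ≤ m) :
    (limit c hK hK').status f = (A m).status (f.seq m) :=
  (f.status_eq_of_le hK (hK' _) hm).symm

theorem limit_status_of_le (f : Thread c) {m : ℕ} (hm : (limit c hK hK').lvl f ≤ K m) :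
    (limit c hK hK').status f = (A m).status (f.seq m) := by
  rcases le_total m ((limit c hK hK').lvl f) with h | h
  · exact f.status_eq_of_le hK hm h
  · exact limit_status hK hK' f h

/-- The projection of the inverse limit to the `m`-th arena. -/
def limitHom (m : ℕ) : Hom (limit c hK hK') (A m) where
  toFun f := f.seq m
  lvl_toFun f := f.lvl_eq m
  par_toFun _ := rfl
  alive f h := by
    rw [limit_status hK hK' f (le_max_left _ m)] at h
    exact f.alive_of_le (le_max_right _ _) h

/-- A strategy for the inverse limit, read in the `m`-th arena as far as the projection is an
isomorphism, and continued arbitrarily. -/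
theorem exists_projStrat (m : ℕ) : ∃ t : (limit c hK hK').Strat → (A m).Strat,
    (∀ s (f : Thread c), (A m).lvl (f.seq m) < K m → t s (f.seq m) = (s f).seq m) ∧
    ∀ s s' n, (∀ f, (limit c hK hK').lvl f ≤ n → s f = s' f) →
      ∀ a, (A m).lvl a ≤ n → t s a = t s' a := by
  classical
  obtain ⟨d⟩ := (inferInstance : Nonempty (A m).Strat)
  let v (s : (limit c hK hK').Strat) (a : (A m).Pos) : (A m).Pos :=
    if h : ∃ f : Thread c, f.seq m = a ∧ (A m).lvl a < K m then (s h.choose).seq m else d a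
  refine ⟨fun s => ⟨v s, fun a => ?_⟩, fun s f hf => ?_, fun s s' n h a ha => ?_⟩
  · by_cases h : ∃ f : Thread c, f.seq m = a ∧ (A m).lvl a < K m
    · have := (limitHom hK hK' m).map_isChild (s.isChild h.choose)
      simp only [limitHom, h.choose_spec.1] at this
      simpa only [v, dif_pos h] using this
    · simpa only [v, dif_neg h] using d.isChild a
  · have h : ∃ g : Thread c, g.seq m = f.seq m ∧ (A m).lvl (f.seq m) < K m := ⟨f, rfl, hf⟩
    have hg : h.choose = f :=
      Thread.eq_of_apply_eq hK (by rw [h.choose_spec.1]; exact hf.le) h.choose_spec.1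
    change v s (f.seq m) = _
    simp only [v, dif_pos h]
    rw [hg]
  · change v s a = v s' a
    by_cases hf : ∃ f : Thread c, f.seq m = a ∧ (A m).lvl a < K m
    · simp only [v, dif_pos hf]
      refine congrArg (fun g : Thread c => g.seq m) (h _ ?_)
      rw [← limit_lvl hK hK' _ m, hf.choose_spec.1]
      exact ha
    · simp only [v, dif_neg hf]

/-- Transfer down `j` coverings, from the `m + j`-th arena to the `m`-th, of a sequence of
strategies. -/
def iterStrat (i : Player) (t : ∀ m, (A m).Strat) (c : ∀ m, Cover (K m) (A (m + 1)) (A m)) :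
    ℕ → ∀ m, (A m).Strat
  | 0, m => t m
  | j + 1, m => (c m).strat i (iterStrat i t c j (m + 1))

theorem iterStrat_congr {i : Player} {t t' : ∀ m, (A m).Strat} {n : ℕ}
    (h : ∀ m a, (A m).lvl a ≤ n → t m a = t' m a) (j m : ℕ) (a : (A m).Pos)
    (ha : (A m).lvl a ≤ n) : iterStrat i t c j m a = iterStrat i t' c j m a := by
  induction j generalizing m with
  | zero => exact h m a ha
  | succ j ih => exact (c m).strat_local i _ _ n (fun b hb => ih _ b hb) a ha

/-- A strategy for the inverse limit induces strategies in all arenas of the sequence that agree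
with it as far as the projections are isomorphisms and that are transferred to one another. They
arise by transferring down its reading in an arena farther and farther out; by locality, the
resulting moves at a fixed position stabilize. -/
theorem exists_limitStrat (i : Player) : ∃ t : (limit c hK hK').Strat → ∀ m, (A m).Strat,
    (∀ s m (f : Thread c), (A m).lvl (f.seq m) < K m → t s m (f.seq m) = (s f).seq m) ∧
    (∀ s m a, t s m a = (c m).strat i (t s (m + 1)) a) ∧
    ∀ s s' n, (∀ f, (limit c hK hK').lvl f ≤ n → s f = s' f) →
      ∀ m a, (A m).lvl a ≤ n → t s m a = t s' m a := by
  choose r hr hr' using exists_projStrat (c := c) hK hK'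
  let D s j m := iterStrat i (fun m => r m s) c j m
  have step : ∀ s j m a, (A m).lvl a < K (m + j) → D s (j + 1) m a = D s j m a := by
    intro s j
    induction j with
    | zero =>
      intro m a ha
      obtain ⟨f, hf, rfl⟩ := exists_thread hK c m a ha.le
      change (c m).strat i (r (m + 1) s) (f m) = r m s (f m)
      have h1 : (A (m + 1)).lvl (f (m + 1)) = (A m).lvl (f m) := by
        rw [← hf m, (c m).lvl_toFun]
      rw [hr m s ⟨f, hf⟩ ha]
      have h2 := (c m).strat_low i (r (m + 1) s) (f (m + 1)) (by rw [h1]; exact ha)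
      rw [hf m, hr (m + 1) s ⟨f, hf⟩ (by rw [h1]; exact ha.trans_le (hK m.le_succ))] at h2
      exact h2.trans ((s _).map_seq m)
    | succ j ih =>
      intro m a ha
      refine (c m).strat_local i _ _ ((A m).lvl a) (fun b hb => ?_) a le_rfl
      exact ih (m + 1) b (hb.trans_lt (by rwa [add_right_comm, add_assoc]))
  have stable : ∀ s m a j j', (A m).lvl a < K (m + j) → j ≤ j' → D s j' m a = D s j m a := by
    intro s m a j j' h hj
    induction j', hj using Nat.le_induction with
    | base => rfl
    | succ j' hj' ih => rw [step _ _ _ _ (h.trans_le (hK (by omega))), ih]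
  have big : ∀ m n j, n < j → n < K (m + j) := fun m n j h =>
    (h.trans_le (Nat.le_add_left _ _)).trans_le (hK' _)
  refine ⟨fun s m => ⟨fun a => D s ((A m).lvl a + 1) m a, fun a => (D s _ m).isChild a⟩,
    fun s m f hf => ?_, fun s m a => ?_, fun s s' n h m a ha => ?_⟩
  · change D s ((A m).lvl (f.seq m) + 1) m (f.seq m) = _
    rw [stable s m _ 0 _ hf (Nat.zero_le _)]
    exact hr m s f hf
  · change D s ((A m).lvl a + 1) m a = _
    rw [← stable s m a _ ((A m).lvl a + 2) (big _ _ _ (Nat.lt_succ_self _)) (Nat.le_succ _)]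
    refine (c m).strat_local i _ _ ((A m).lvl a) (fun b hb => ?_) a le_rfl
    exact stable s (m + 1) b _ _ (big _ _ _ (Nat.lt_succ_self _)) (by omega)
  · exact iterStrat_congr (fun m a ha => hr' m s s' n h a ha) _ m a ha

variable (c) in
/-- The inverse limit covers the first arena. Shadowing plays are found by lifting a play step by
step. If none of the lifts is ever lost by the owner of the strategy, they form a coherent sequence.
Otherwise they cohere up to the least length `N` at which some lift is lost, and a lift lost there
determines a position of length `N` of the limit, lost as well. -/
noncomputable def limitCover : Cover (K 0) (limit c hK hK') (A 0) where
  toHom := limitHom hK hK' 0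
  inj f g hf _ h := Thread.eq_of_apply_eq hK (M := 0) hf h
  surj a ha := by
    obtain ⟨f, hf, rfl⟩ := exists_thread hK c 0 a ha
    exact ⟨⟨f, hf⟩, rfl⟩
  status_eq f hf := limit_status_of_le hK hK' f hf
  strat i s := (exists_limitStrat hK hK' i).choose s 0
  strat_low i s f hf := (exists_limitStrat hK hK' i).choose_spec.1 s 0 f hf
  strat_local i s s' n h := (exists_limitStrat hK hK' i).choose_spec.2.2 s s' n h 0
  lift i s x hx hxs := by
    obtain ⟨hlow, hstep, -⟩ := (exists_limitStrat (c := c) hK hK' i).choose_spec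
    set t := (exists_limitStrat (c := c) hK hK' i).choose s with ht
    replace hlow := hlow s
    have hstep' : ∀ m, t m = (c m).strat i (t (m + 1)) := by
      intro m
      have := hstep s m
      rw [← ht] at this
      cases h1 : t m; cases h2 : (c m).strat i (t (m + 1))
      rw [h1, h2] at this
      congr 1
      exact funext this
    rw [← ht] at hlow
    have next : ∀ m, ∀ z : {z // (A m).IsBranch z ∧ (A m).FollowsFrom i (t m) 0 z},
        ∃ z' : {z // (A (m + 1)).IsBranch z ∧ (A (m + 1)).FollowsFrom i (t (m + 1)) 0 z},
          ∀ n, (A (m + 1)).status (z'.1 n) = some i ∨ ((c m).toFun (z'.1 n) = z.1 n ∧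
            (A (m + 1)).status (z'.1 n) = (A m).status (z.1 n)) := by
      rintro m ⟨z, hz, hzs⟩
      rw [hstep'] at hzs
      obtain ⟨y, hy, hys, hyz⟩ := (c m).lift i _ z hz hzs
      exact ⟨⟨y, hy, hys⟩, hyz⟩
    choose G hG using next
    let Z : ∀ m, {z // (A m).IsBranch z ∧ (A m).FollowsFrom i (t m) 0 z} :=
      fun m => Nat.rec ⟨x, hx, hxs⟩ (fun m z => G m z) m
    have hZ : ∀ m n, (A (m + 1)).status ((Z (m + 1)).1 n) = some i ∨
        ((c m).toFun ((Z (m + 1)).1 n) = (Z m).1 n ∧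
          (A (m + 1)).status ((Z (m + 1)).1 n) = (A m).status ((Z m).1 n)) :=
      fun m n => hG m (Z m) n
    have hZl : ∀ m n, (A m).lvl ((Z m).1 n) = n := fun m n => (Z m).2.1.lvl_eq n
    -- Threads through successive positions of one lift, within the range of the isomorphisms,
    -- form a play of the limit by `s`.
    have thread : ∀ M n, n ≤ K M → ∃ f : Thread c, f.seq M = (Z M).1 n := by
      intro M n hn
      obtain ⟨f, hf, hfM⟩ := exists_thread hK c M ((Z M).1 n) (by rwa [hZl])
      exact ⟨⟨f, hf⟩, hfM⟩
    have follow : ∀ M n (f g : Thread c), n < K M → f.seq M = (Z M).1 n →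
        g.seq M = (Z M).1 (n + 1) → (limit c hK hK').IsChild g f ∧ (i.ToMove n → g = s f) := by
      intro M n f g hn hf hg
      have hb := (Z M).2.1.isChild n
      refine ⟨⟨?_, Thread.eq_of_apply_eq hK (M := M) ?_ ?_⟩, fun hi => ?_⟩
      · rw [← limit_lvl hK hK' g M, ← limit_lvl hK hK' f M, hf, hg, hb.1]
      · change (A M).lvl ((A M).par (g.seq M)) ≤ K M
        rw [(A M).lvl_par, hg, hZl]; omega
      · change (A M).par (g.seq M) = _
        rw [hg, hb.2, hf]
      · refine Thread.eq_of_apply_eq hK (M := M) (by rw [hg, hZl]; exact hn) ?_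
        rw [hg, (Z M).2.2 n (Nat.zero_le _) hi, ← hf]
        exact hlow M f (by rw [hf, hZl]; exact hn)
    by_cases hlost : ∃ n m, (A m).status ((Z m).1 n) = some i
    · classical
      set N := Nat.find hlost with hN
      obtain ⟨m, hm⟩ := Nat.find_spec hlost
      rw [← hN] at hm
      have hmin : ∀ n < N, ∀ m, (A m).status ((Z m).1 n) ≠ some i :=
        fun n hn m h => Nat.find_min hlost hn ⟨m, h⟩
      obtain ⟨M, hNM, hM⟩ : ∃ M, N ≤ K M ∧ (A M).status ((Z M).1 N) = some i := by
        refine ⟨max m N, (le_max_right m N).trans (hK' _), ?_⟩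
        induction max m N, le_max_left m N using Nat.le_induction with
        | base => exact hm
        | succ j _ ih => exact (hZ j N).elim id fun h => h.2.trans ih
      have : Nonempty (Thread c) := ⟨(thread 0 0 (Nat.zero_le _)).choose⟩
      choose! f hf using fun n (hn : n ≤ N) => thread M n (hn.trans hNM)
      have hf0 : ∀ n < N, (f n).seq 0 = x n := by
        intro n hn
        have : ∀ j ≤ M, (f n).seq j = (Z j).1 n := by
          intro j hj
          induction hj using Nat.decreasingInduction with
          | self => exact hf n hn.le
          | of_succ j _ ih =>
            rw [← (f n).map_seq, ih]
            exact ((hZ j n).resolve_left (hmin n hn _)).1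
        exact this 0 (Nat.zero_le _)
      have hst : ∀ n < N, (limit c hK hK').status (f n) = (A 0).status (x n) := by
        intro n hn
        rw [limit_status_of_le hK hK' (f n) (m := M)
          (by rw [← limit_lvl hK hK' _ M, hf n hn.le, hZl]; exact hn.le.trans hNM), hf n hn.le]
        clear * - hZ hmin hn
        induction M with
        | zero => rfl
        | succ j ih => exact ((hZ j n).resolve_left (hmin n hn _)).2.trans ih
      obtain ⟨y, hy, hyf, hys⟩ := exists_branch_extending (A := limit c hK hK') (z := f) (N := N)
        (by rw [← limit_lvl hK hK' _ M, hf 0 (Nat.zero_le _), hZl])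
        (fun n hn => (follow M n _ _ (hn.trans_le hNM) (hf n hn.le) (hf (n + 1) hn)).1) s
      refine ⟨y, hy, fun n _ hi => ?_, fun n => ?_⟩
      · rcases lt_or_ge n N with hn | hn
        · rw [hyf n hn.le, hyf (n + 1) hn]
          exact (follow M n _ _ (hn.trans_le hNM) (hf n hn.le) (hf (n + 1) hn)).2 hi
        · exact hys n hn
      · rcases lt_or_ge n N with hn | hn
        · rw [hyf n hn.le]
          exact Or.inr ⟨hf0 n hn, hst n hn⟩
        · refine Or.inl (hy.status_of_le (m := N) ?_ hn)
          rw [hyf N le_rfl, limit_status_of_le hK hK' (f N) (m := M)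
            (by rw [← limit_lvl hK hK' _ M, hf N le_rfl, hZl]; exact hNM), hf N le_rfl, hM]
    · push Not at hlost
      have hcoh := fun m n => (hZ m n).resolve_left (hlost n (m + 1))
      let y : ℕ → Thread c := fun n => ⟨fun m => (Z m).1 n, fun m => (hcoh m n).1⟩
      have hch : ∀ n, (limit c hK hK').IsChild (y (n + 1)) (y n) ∧
          (i.ToMove n → y (n + 1) = s (y n)) :=
        fun n => follow (n + 1) n _ _ (hK' (n + 1)) rfl rfl
      refine ⟨y, ⟨hx.lvl_zero, fun n => (hch n).1⟩, fun n _ => (hch n).2,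
        fun n => Or.inr ⟨rfl, ?_⟩⟩
      rw [limit_status hK hK' (y n) le_rfl]
      induction (limit c hK hK').lvl (y n) with
      | zero => rfl
      | succ j ih => exact (hcoh j n).2.trans ih

end Limit

/-! ### Unravelling open sets -/

/-- `W` is open among the plays without taboos. -/
def IsOpenOn (A : Arena.{u}) (W : Set (ℕ → A.Pos)) : Prop :=
  ∀ x, A.IsAlive x → x ∈ W → ∃ n, ∀ y, A.IsAlive y → y n = x n → y ∈ W

/-- `W` is clopen among the plays without taboos. -/
def IsClopenOn (A : Arena.{u}) (W : Set (ℕ → A.Pos)) : Prop :=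
  ∀ x, A.IsAlive x → ∃ n, ∀ y, A.IsAlive y → y n = x n → (y ∈ W ↔ x ∈ W)

section Prefix

variable {A : Arena.{u}}

/-- The position `u` is an initial segment of `p`. -/
def IsPrefix (u p : A.Pos) : Prop := A.lvl u ≤ A.lvl p ∧ A.par^[A.lvl p - A.lvl u] p = u

/-- One of `p` and `u` is an initial segment of the other: they become equal when the longer one is
cut down to the length of the shorter one (one of the truncated differences is `0`). -/
def Comparable (p u : A.Pos) : Prop :=
  A.par^[A.lvl p - A.lvl u] p = A.par^[A.lvl u - A.lvl p] u

theorem IsPrefix.comparable {u p : A.Pos} (h : IsPrefix u p) : Comparable p u := by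
  rw [Comparable, h.2, Nat.sub_eq_zero_of_le h.1]; rfl

theorem IsPrefix.refl (p : A.Pos) : IsPrefix p p := ⟨le_rfl, by simp⟩

theorem IsChild.isPrefix_iff {u p q : A.Pos} (h : A.IsChild q p) :
    IsPrefix u q ↔ u = q ∨ IsPrefix u p := by
  constructor
  · rintro ⟨h1, h2⟩
    rcases h1.eq_or_lt with h3 | h3
    · left; rw [← h2, h3]; simp
    · right
      rw [h.1] at h3 h2
      refine ⟨by omega, ?_⟩
      rw [Nat.sub_add_comm (by omega), Function.iterate_succ_apply, h.2] at h2
      exact h2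
  · rintro (rfl | ⟨h1, h2⟩)
    · exact IsPrefix.refl _
    · refine ⟨by rw [h.1]; omega, ?_⟩
      rw [h.1, Nat.sub_add_comm h1, Function.iterate_succ_apply, h.2, h2]

theorem IsBranch.isPrefix_iff {x : ℕ → A.Pos} (hx : A.IsBranch x) {u : A.Pos} {n : ℕ} :
    IsPrefix u (x n) ↔ A.lvl u ≤ n ∧ x (A.lvl u) = u := by
  rw [IsPrefix, hx.lvl_eq]
  refine and_congr_right fun h => ?_
  obtain ⟨j, hj⟩ := Nat.exists_eq_add_of_le h
  rw [hj, Nat.add_sub_cancel_left, hx.iterate_par]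

theorem IsBranch.comparable {x : ℕ → A.Pos} (hx : A.IsBranch x) {u : A.Pos}
    (hu : x (A.lvl u) = u) (n : ℕ) : Comparable (x n) u := by
  rw [Comparable, hx.lvl_eq]
  rcases le_total n (A.lvl u) with h | h
  · obtain ⟨j, hj⟩ := Nat.exists_eq_add_of_le h
    rw [Nat.sub_eq_zero_of_le h, ← congrArg (A.par^[_]) hu, hj, Nat.add_sub_cancel_left,
      hx.iterate_par]
    rfl
  · obtain ⟨j, hj⟩ := Nat.exists_eq_add_of_le h
    rw [Nat.sub_eq_zero_of_le h, hj, Nat.add_sub_cancel_left, hx.iterate_par, hu]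
    rfl

theorem Comparable.of_isChild {p q u : A.Pos} (h : A.IsChild q p) (hq : Comparable q u) :
    Comparable p u := by
  rw [Comparable, h.1] at *
  rcases lt_or_ge (A.lvl p) (A.lvl u) with hl | hl
  · rw [Nat.sub_eq_zero_of_le (by omega)] at hq ⊢
    change q = _ at hq
    change p = _
    refine (h.2.symm.trans ((congrArg A.par hq).trans
      (Function.iterate_succ_apply' A.par _ u).symm)).trans ?_
    congr 1; omega
  · rw [Nat.sub_add_comm hl, Function.iterate_succ_apply, h.2] at hq
    rw [hq]
    congr 1; omega

theorem Comparable.exists_isChild {p u : A.Pos} (h : Comparable p u) :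
    ∃ q, A.IsChild q p ∧ Comparable q u := by
  rcases lt_or_ge (A.lvl p) (A.lvl u) with hl | hl
  · have hlvl : A.lvl (A.par^[A.lvl u - (A.lvl p + 1)] u) = A.lvl p + 1 := by
      rw [lvl_iterate_par]; omega
    refine ⟨A.par^[A.lvl u - (A.lvl p + 1)] u, ⟨hlvl, ?_⟩, ?_⟩
    · rw [← Function.iterate_succ_apply' (f := A.par)]
      rw [Comparable, Nat.sub_eq_zero_of_le hl.le] at h
      change p = _ at h
      refine Eq.trans ?_ h.symm
      congr 1; omega
    · rw [Comparable, hlvl, Nat.sub_eq_zero_of_le (by omega)]; rfl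
  · obtain ⟨q, hq⟩ := A.exists_child p
    refine ⟨q, hq, IsPrefix.comparable ((IsChild.isPrefix_iff hq).2 (Or.inr ⟨hl, ?_⟩))⟩
    rw [Comparable, Nat.sub_eq_zero_of_le hl] at h
    exact h

theorem Comparable.isChild_unique {p q q' u : A.Pos} (hl : A.lvl p < A.lvl u)
    (h : A.IsChild q p) (h' : A.IsChild q' p) (hq : Comparable q u) (hq' : Comparable q' u) :
    q = q' := by
  rw [Comparable, h.1, Nat.sub_eq_zero_of_le (by omega)] at hq
  rw [Comparable, h'.1, Nat.sub_eq_zero_of_le (by omega)] at hq'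
  exact hq.trans hq'.symm

end Prefix

namespace Unravel

variable (A : Arena.{u}) (k : ℕ) (E : Set A.Pos)

/-- The positions of length at least `k + 2` at which play exits the complement of `E`, without
taboos so far. A play that has entered `E` by length `k + 1` is counted as doing so at length
`k + 2`. -/
def exits : Set A.Pos :=
  {u | u ∈ E ∧ k + 2 ≤ A.lvl u ∧ (A.lvl u = k + 2 ∨ A.par u ∉ E) ∧ A.status u = none}

/-- The positions of the unravelled game. With move `k` a player `P` also announces a set `claim`;
with move `k + 1` the opponent may challenge an exit in that set, after which both players must
play towards this exit. -/
@[ext]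
structure UPos : Type u where
  pos : A.Pos
  claim : Set A.Pos
  chal : Option A.Pos
  claim_low : A.lvl pos ≤ k → claim = ∅
  chal_low : A.lvl pos ≤ k + 1 → chal = none
  chal_mem : ∀ u, chal = some u → u ∈ exits A k E ∧ u ∈ claim ∧ Comparable pos u

variable {A k E}

open Classical in
/-- The position over `p` with claim `Y` and challenge `c`, as far as these make sense at `p`. -/
noncomputable def emb (p : A.Pos) (Y : Set A.Pos) (c : Option A.Pos) : UPos A k E where
  pos := p
  claim := if A.lvl p ≤ k then ∅ else Y
  chal := if k + 2 ≤ A.lvl p ∧ ∀ u, c = some u → u ∈ exits A k E ∧ u ∈ Y ∧ Comparable p u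
    then c else none
  claim_low h := if_pos h
  chal_low h := if_neg fun h' => by omega
  chal_mem u hu := by
    split_ifs at hu with h
    rw [if_neg (by omega)]
    exact h.2 u hu

theorem emb_claim {p : A.Pos} {Y : Set A.Pos} {c : Option A.Pos} (h : k < A.lvl p) :
    (emb p Y c : UPos A k E).claim = Y := if_neg (by omega)

theorem emb_chal_none {p : A.Pos} {Y : Set A.Pos} : (emb p Y none : UPos A k E).chal = none := by
  simp [emb]

theorem emb_chal {p : A.Pos} {Y : Set A.Pos} {c : Option A.Pos} (h : k + 2 ≤ A.lvl p)
    (hc : ∀ u, c = some u → u ∈ exits A k E ∧ u ∈ Y ∧ Comparable p u) :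
    (emb p Y c : UPos A k E).chal = c := if_pos ⟨h, hc⟩

theorem eq_of_low {b b' : UPos A k E} (h : A.lvl b.pos ≤ k) (hb : b.pos = b'.pos) : b = b' := by
  refine UPos.ext hb ?_ ?_
  · rw [b.claim_low h, b'.claim_low (hb ▸ h)]
  · rw [b.chal_low (by omega), b'.chal_low (by rw [← hb]; omega)]

/-- The position before the last move. -/
noncomputable def upar (b : UPos A k E) : UPos A k E := emb (A.par b.pos) b.claim b.chal

theorem upar_chal {b : UPos A k E} (h : k + 3 ≤ A.lvl b.pos) : (upar b).chal = b.chal := by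
  refine emb_chal (by rw [A.lvl_par]; omega) fun u hu => ?_
  obtain ⟨h1, h2, h3⟩ := b.chal_mem u hu
  exact ⟨h1, h2, h3.of_isChild ⟨by rw [A.lvl_par]; omega, rfl⟩⟩

/-- A move in `A` that respects the challenge, if any, gives a successor in the unravelled game. -/
theorem upar_mk {b : UPos A k E} {q : A.Pos} (hq : A.IsChild q b.pos)
    (hc : ∀ u, b.chal = some u → Comparable q u) : upar (emb q b.claim b.chal) = b := by
  have hcl : (emb q b.claim b.chal : UPos A k E).claim = if A.lvl q ≤ k then ∅ else b.claim := rfl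
  have hch : A.lvl q ≤ k + 1 ∨ (emb q b.claim b.chal : UPos A k E).chal = b.chal := by
    rcases Nat.lt_or_ge (k + 1) (A.lvl q) with h | h
    · exact Or.inr (emb_chal h fun u hu => ⟨(b.chal_mem u hu).1, (b.chal_mem u hu).2.1, hc u hu⟩)
    · exact Or.inl h
  refine UPos.ext hq.2 ?_ ?_
  · change (if A.lvl (A.par q) ≤ k then ∅ else _) = _
    rw [hq.2]
    split_ifs with h
    · exact (b.claim_low h).symm
    · rw [hcl, if_neg (by rw [hq.1]; omega)]
  · rcases Nat.lt_or_ge (k + 2) (A.lvl q) with h | h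
    · rw [upar_chal (b := emb q b.claim b.chal) h]
      exact hch.resolve_left (by omega)
    · rw [b.chal_low (by have := hq.1; omega)]
      exact UPos.chal_low _ (by change A.lvl (A.par q) ≤ _; rw [A.lvl_par]; omega)

open Classical in
/-- The status of a position when no challenge has been made: `P` guarantees that no exit outside
the announced set `Y` is reached, and the opponent that no exit in `Y` is reached. -/
noncomputable def accStatus (k : ℕ) (E : Set A.Pos) (P : Player) (Y : Set A.Pos) (p : A.Pos) :
    Option Player :=
  if ∃ u ∈ exits A k E, IsPrefix u p ∧ u ∈ Y then some P.other
  else if ∃ u ∈ exits A k E, IsPrefix u p then some P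
  else A.status p

theorem accStatus_low {P : Player} {Y : Set A.Pos} {p : A.Pos} (h : A.lvl p ≤ k + 1) :
    accStatus k E P Y p = A.status p := by
  have : ¬ ∃ u ∈ exits A k E, IsPrefix u p := by
    rintro ⟨u, hu, hup⟩
    have := hu.2.1.trans hup.1
    omega
  rw [accStatus, if_neg fun ⟨u, hu, hup, _⟩ => this ⟨u, hu, hup⟩, if_neg this]

theorem accStatus_none {P : Player} {Y : Set A.Pos} {p : A.Pos}
    (h : accStatus k E P Y p = none) :
    A.status p = none ∧ ∀ u ∈ exits A k E, ¬ IsPrefix u p := by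
  unfold accStatus at h
  split_ifs at h with h1 h2
  exact ⟨h, fun u hu hup => h2 ⟨u, hu, hup⟩⟩

variable (hE : ∀ p q, A.IsChild q p → p ∈ E → q ∈ E)

include hE

theorem mem_of_isPrefix {u p : A.Pos} (h : IsPrefix u p) (hu : u ∈ E) : p ∈ E := by
  obtain ⟨x, hx, hxp⟩ := exists_branch_through p
  rw [← hxp, hx.isPrefix_iff] at h
  rw [← hxp]
  induction A.lvl p, h.1 using Nat.le_induction with
  | base => rwa [h.2]
  | succ n _ ih => exact hE _ _ (hx.isChild n) ih

theorem exit_unique {u v p : A.Pos} (hu : u ∈ exits A k E) (hv : v ∈ exits A k E)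
    (hup : IsPrefix u p) (hvp : IsPrefix v p) : u = v := by
  wlog h : A.lvl u ≤ A.lvl v generalizing u v
  · exact (this hv hu hvp hup (le_of_not_ge h)).symm
  obtain ⟨x, hx, hxp⟩ := exists_branch_through p
  rw [← hxp, hx.isPrefix_iff] at hup hvp
  rcases h.eq_or_lt with h' | h'
  · rw [← hup.2, ← hvp.2, h']
  · exfalso
    rcases hv.2.2.1 with h1 | h1
    · have := hu.2.1; omega
    · refine h1 (mem_of_isPrefix hE (u := u) ?_ hu.1)
      rw [← hvp.2]
      obtain ⟨m, hm⟩ : ∃ m, A.lvl v = m + 1 := Nat.exists_eq_succ_of_ne_zero (by omega)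
      rw [hm, (hx.isChild m).2, hx.isPrefix_iff]
      exact ⟨by omega, hup.2⟩

theorem accStatus_isChild {P : Player} {Y : Set A.Pos} {p q : A.Pos} (h : A.IsChild q p)
    {i : Player} (hp : accStatus k E P Y p = some i) : accStatus k E P Y q = some i := by
  have up : ∀ u, IsPrefix u p → IsPrefix u q := fun u hu => h.isPrefix_iff.2 (Or.inr hu)
  unfold accStatus at hp
  split_ifs at hp with h1 h2
  · obtain ⟨u, hu, hup, huY⟩ := h1
    rw [accStatus, if_pos ⟨u, hu, up u hup, huY⟩, hp]
  · obtain ⟨u, hu, hup⟩ := h2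
    rw [accStatus, if_neg, if_pos ⟨u, hu, up u hup⟩, hp]
    rintro ⟨v, hv, hvq, hvY⟩
    obtain rfl := exit_unique hE hu hv (up u hup) hvq
    exact h1 ⟨u, hu, hup, hvY⟩
  · have hq : A.status q = some i := A.status_par q i (by rw [h.2, hp])
    have : ¬ ∃ u ∈ exits A k E, IsPrefix u q := by
      rintro ⟨u, hu, huq⟩
      rcases h.isPrefix_iff.1 huq with rfl | hup
      · rw [hu.2.2.2] at hq; cases hq
      · exact h2 ⟨u, hu, hup⟩
    rw [accStatus, if_neg fun ⟨u, hu, huq, _⟩ => this ⟨u, hu, huq⟩, if_neg this, hq]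

/-- The unravelled game, where `P` is to move at length `k`. -/
noncomputable def arena (P : Player) : Arena.{u} where
  Pos := UPos A k E
  lvl b := A.lvl b.pos
  par := upar
  status b := if b.chal = none then accStatus k E P b.claim b.pos else A.status b.pos
  lvl_par b := A.lvl_par b.pos
  exists_child b := by
    have : ∃ q, A.IsChild q b.pos ∧ ∀ u, b.chal = some u → Comparable q u := by
      cases h : b.chal with
      | none =>
        obtain ⟨q, hq⟩ := A.exists_child b.pos
        exact ⟨q, hq, by simp⟩
      | some u =>
        obtain ⟨q, hq, hqu⟩ := (b.chal_mem u h).2.2.exists_isChild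
        exact ⟨q, hq, by rintro v ⟨⟩; exact hqu⟩
    obtain ⟨q, hq, hqc⟩ := this
    exact ⟨emb q b.claim b.chal, hq.1, upar_mk hq hqc⟩
  status_par b i h := by
    change (if (upar b).chal = none then accStatus k E P (upar b).claim (A.par b.pos)
      else A.status (A.par b.pos)) = some i at h
    rcases Nat.lt_or_ge (k + 2) (A.lvl b.pos) with hl | hl
    · have hc : A.IsChild b.pos (A.par b.pos) := ⟨by rw [A.lvl_par]; omega, rfl⟩
      have hcl : (upar b).claim = b.claim := emb_claim (by rw [A.lvl_par]; omega)
      rw [upar_chal hl, hcl] at h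
      split_ifs at h ⊢ with h1
      · exact accStatus_isChild hE hc h
      · exact A.status_par _ i h
    · rw [if_pos ((upar b).chal_low (by change A.lvl (A.par b.pos) ≤ _; rw [A.lvl_par]; omega)),
        accStatus_low (by rw [A.lvl_par]; omega)] at h
      split_ifs with h1
      · rcases Nat.lt_or_ge (k + 1) (A.lvl b.pos) with hl' | hl'
        · have hc : A.IsChild b.pos (A.par b.pos) := ⟨by rw [A.lvl_par]; omega, rfl⟩
          refine accStatus_isChild hE hc ?_
          rw [accStatus_low (by rw [A.lvl_par]; omega), h]
        · rw [accStatus_low hl']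
          exact A.status_par _ i h
      · exact A.status_par _ i h

variable {P : Player}

theorem isChild_pos {b c : UPos A k E} (h : (arena hE P).IsChild b c) : A.IsChild b.pos c.pos :=
  ⟨h.1, congrArg UPos.pos h.2⟩

theorem isChild_claim {b c : UPos A k E} (h : (arena hE P).IsChild b c)
    (hl : k < A.lvl c.pos) : b.claim = c.claim := by
  have h2 : upar b = c := h.2
  rw [← h2]
  exact (emb_claim (by rwa [← h2] at hl)).symm

theorem isChild_chal {b c : UPos A k E} (h : (arena hE P).IsChild b c)
    (hl : k + 2 ≤ A.lvl c.pos) : b.chal = c.chal := by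
  have h2 : upar b = c := h.2
  rw [← h2]
  refine (upar_chal ?_).symm
  have := (isChild_pos hE h).1
  omega

/-- Forgetting announcements and challenges. -/
noncomputable def hom (P : Player) : Hom (arena hE P (k := k)) A where
  toFun := UPos.pos
  lvl_toFun _ := rfl
  par_toFun _ := rfl
  alive b h := by
    change (if b.chal = none then accStatus k E P b.claim b.pos else A.status b.pos) = none at h
    split_ifs at h
    exacts [(accStatus_none h).1, h]

/-- A fixed announcement and a fixed challenge met by the play `x` turn `x` into a play of the
unravelled game. -/
theorem isBranch_emb {x : ℕ → A.Pos} (hx : A.IsBranch x) {Y : Set A.Pos} {c : Option A.Pos}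
    (hc : ∀ u, c = some u → u ∈ exits A k E ∧ u ∈ Y ∧ x (A.lvl u) = u) :
    (arena hE P).IsBranch (fun n => (emb (x n) Y c : UPos A k E)) := by
  have hc' : ∀ n u, c = some u → u ∈ exits A k E ∧ u ∈ Y ∧ Comparable (x n) u := fun n u hu =>
    ⟨(hc u hu).1, (hc u hu).2.1, hx.comparable (hc u hu).2.2 n⟩
  refine ⟨hx.lvl_zero, fun n => ⟨(hx.isChild n).1, ?_⟩⟩
  have hl := hx.lvl_eq n
  have hl' := hx.lvl_eq (n + 1)
  refine UPos.ext (hx.isChild n).2 ?_ ?_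
  · change (if A.lvl (A.par (x (n + 1))) ≤ k then ∅ else if A.lvl (x (n + 1)) ≤ k then ∅ else Y) =
      if A.lvl (x n) ≤ k then ∅ else Y
    rw [(hx.isChild n).2]
    split_ifs <;> first | rfl | omega
  · change (upar _).chal = _
    rcases Nat.lt_or_ge n (k + 2) with h | h
    · rw [UPos.chal_low, UPos.chal_low]
      · change A.lvl (x n) ≤ _; omega
      · change A.lvl (A.par (x (n + 1))) ≤ _; rw [A.lvl_par]; omega
    · rw [upar_chal (by change k + 3 ≤ A.lvl (x (n + 1)); omega), emb_chal (by omega) (hc' _),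
        emb_chal (by omega) (hc' _)]

end Unravel

/-! ### Transfer of strategies from the unravelled game -/

namespace Unravel

variable {A : Arena.{u}} {k : ℕ} {E : Set A.Pos} (hE : ∀ p q, A.IsChild q p → p ∈ E → q ∈ E)
  {P : Player}

open Classical in
/-- The position of the unravelled game in which `P` imagines to be after `p`, having announced
`Y`: the opponent is taken not to have challenged until an exit in `Y` is reached, and from then on
to have challenged this exit. -/
noncomputable def claimantSim (Y : Set A.Pos) (p : A.Pos) : UPos A k E :=
  emb p Y (if h : ∃ u, u ∈ exits A k E ∧ u ∈ Y ∧ IsPrefix u p then some h.choose else none)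

open Classical in
/-- The position of the unravelled game in which the opponent of `P` imagines to be after `p`, if
`g Y` is the reply to an announced set `Y`. The announcement is taken to be the set of positions
that are challenged in reply to no announcement at all, until a position outside this set is
reached; from then on it is taken to be one to which the reply was to challenge that position. -/
noncomputable def challengerSim (g : Set A.Pos → Option A.Pos) (p : A.Pos) : UPos A k E :=
  if h : ∃ u, u ∈ exits A k E ∧ IsPrefix u p ∧ ∃ Y, g Y = some u then
    emb p h.choose_spec.2.2.choose (some h.choose)
  else emb p {u | ¬ ∃ Y, g Y = some u} none

include hE in
theorem claimantSim_of_mem {Y : Set A.Pos} {p u : A.Pos} (hu : u ∈ exits A k E) (huY : u ∈ Y)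
    (hup : IsPrefix u p) : (claimantSim Y p : UPos A k E) = emb p Y (some u) := by
  have h : ∃ u, u ∈ exits A k E ∧ u ∈ Y ∧ IsPrefix u p := ⟨u, hu, huY, hup⟩
  rw [claimantSim, dif_pos h,
    exit_unique hE h.choose_spec.1 hu h.choose_spec.2.2 hup]

theorem claimantSim_of_not {Y : Set A.Pos} {p : A.Pos}
    (h : ¬ ∃ u, u ∈ exits A k E ∧ u ∈ Y ∧ IsPrefix u p) :
    (claimantSim Y p : UPos A k E) = emb p Y none := by
  rw [claimantSim, dif_neg h]

theorem challengerSim_pos (g : Set A.Pos → Option A.Pos) (p : A.Pos) :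
    (challengerSim g p : UPos A k E).pos = p := by
  unfold challengerSim; split_ifs <;> rfl

include hE in
/-- The announcement imagined in `challengerSim` depends only on the exit reached. -/
theorem exists_challengerSim_of_mem {g : Set A.Pos → Option A.Pos} {u : A.Pos}
    (hu : u ∈ exits A k E) (hg : ∃ Y, g Y = some u) :
    ∃ Y, g Y = some u ∧ ∀ p, IsPrefix u p →
      (challengerSim g p : UPos A k E) = emb p Y (some u) := by
  refine ⟨hg.choose, hg.choose_spec, fun p hup => ?_⟩
  have h : ∃ u, u ∈ exits A k E ∧ IsPrefix u p ∧ ∃ Y, g Y = some u := ⟨u, hu, hup, hg⟩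
  rw [challengerSim, dif_pos h]
  have e : h.choose = u := exit_unique hE h.choose_spec.1 hu h.choose_spec.2.1 hup
  congr 1
  · congr 1
    funext Y
    rw [e]
  · rw [e]

theorem challengerSim_of_not {g : Set A.Pos → Option A.Pos} {p : A.Pos}
    (h : ¬ ∃ u, u ∈ exits A k E ∧ IsPrefix u p ∧ ∃ Y, g Y = some u) :
    (challengerSim g p : UPos A k E) = emb p {u | ¬ ∃ Y, g Y = some u} none := by
  rw [challengerSim, dif_neg h]

/-- The set announced by a strategy `s` of `P` on the way to `p`. -/
noncomputable def claimOf (s : (arena hE P (k := k)).Strat) (p : A.Pos) : Set A.Pos :=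
  UPos.claim (s (emb (A.par^[A.lvl p - k] p) ∅ none))

/-- The replies of a strategy `s` of the opponent of `P`, on the way to `p`, to announcements. -/
noncomputable def chalOf (s : (arena hE P (k := k)).Strat) (p : A.Pos) (Y : Set A.Pos) :
    Option A.Pos :=
  UPos.chal (s (emb (A.par^[A.lvl p - (k + 1)] p) Y none))

open Classical in
/-- The position of the unravelled game in which a player using `s` imagines to be. -/
noncomputable def sim (i : Player) (s : (arena hE P (k := k)).Strat) (p : A.Pos) : UPos A k E :=
  if i = P then claimantSim (claimOf hE s p) p else challengerSim (chalOf hE s p) p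

theorem sim_pos (i : Player) (s : (arena hE P (k := k)).Strat) (p : A.Pos) :
    (sim hE i s p).pos = p := by
  unfold sim; split_ifs
  exacts [rfl, challengerSim_pos _ _]

theorem sim_congr (i : Player) {s s' : (arena hE P (k := k)).Strat} {p : A.Pos}
    (h : ∀ b : UPos A k E, A.lvl b.pos ≤ A.lvl p → s b = s' b) :
    sim hE i s p = sim hE i s' p := by
  have h1 : claimOf hE s p = claimOf hE s' p := by
    unfold claimOf
    rw [h]
    change A.lvl (A.par^[_] p) ≤ _
    rw [lvl_iterate_par]; omega
  have h2 : chalOf hE s p = chalOf hE s' p := by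
    funext Y
    unfold chalOf
    rw [h]
    change A.lvl (A.par^[_] p) ≤ _
    rw [lvl_iterate_par]; omega
  rw [sim, sim, h1, h2]

/-- Playing in `A` by a strategy for the unravelled game. -/
noncomputable def transfer (i : Player) (s : (arena hE P (k := k)).Strat) : A.Strat where
  toFun p := UPos.pos (s (sim hE i s p))
  isChild p := by
    have := isChild_pos hE (s.isChild (sim hE i s p))
    rwa [sim_pos] at this

/-- A play of the unravelled game with fixed announcement and challenge follows a strategy `s` if
its special moves are those of `s`, and if its other moves are those of `s` except on the way to a
challenged position, where they are forced. -/
theorem followsFrom_emb {x : ℕ → A.Pos} (hx : A.IsBranch x) {i : Player}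
    {s : (arena hE P (k := k)).Strat} {Y : Set A.Pos} {c : Option A.Pos}
    (hc : ∀ u, c = some u → u ∈ exits A k E ∧ u ∈ Y ∧ x (A.lvl u) = u)
    (hpos : ∀ n, i.ToMove n → UPos.pos (s (emb (x n) Y c)) = x (n + 1) ∨
      ∃ u, c = some u ∧ n < A.lvl u ∧ k + 2 ≤ n)
    (hclaim : i.ToMove k → UPos.claim (s (emb (x k) ∅ none)) = Y)
    (hchal : i.ToMove (k + 1) → UPos.chal (s (emb (x (k + 1)) Y none)) = c) :
    (arena hE P).FollowsFrom i s 0 (fun n => (emb (x n) Y c : UPos A k E)) := by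
  intro n _ hn
  have hy := isBranch_emb hE (P := P) hx hc
  have h1 := hy.isChild n
  have h2 := s.isChild (emb (x n) Y c)
  have hl := hx.lvl_eq n
  have hl' := hx.lvl_eq (n + 1)
  have hl0 : A.lvl (emb (x n) Y c : UPos A k E).pos = n := hl
  have hp : (emb (x (n + 1)) Y c : UPos A k E).pos = UPos.pos (s (emb (x n) Y c)) := by
    rcases hpos n hn with h | ⟨u, hu, hnu, hkn⟩
    · exact h.symm
    · have hch : (emb (x n) Y c : UPos A k E).chal = some u := by
        rw [emb_chal (by omega) fun v hv => ⟨(hc v hv).1, (hc v hv).2.1,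
          hx.comparable (hc v hv).2.2 n⟩, hu]
      refine Comparable.isChild_unique (u := u) (p := x n) (by omega) (isChild_pos hE h1)
        (isChild_pos hE h2) (hx.comparable (hc u hu).2.2 _) ?_
      exact (UPos.chal_mem _ u ((isChild_chal hE h2 (by omega)).trans hch)).2.2
  have hl2 : A.lvl (UPos.pos (s (emb (x n) Y c))) = n + 1 := by rw [← hp]; exact hl'
  refine UPos.ext hp ?_ ?_
  · rcases lt_trichotomy n k with h | rfl | h
    · exact (UPos.claim_low _ (hl'.trans_le (by omega))).trans
        (UPos.claim_low _ (hl2.trans_le (by omega))).symm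
    · change (emb (x (n + 1)) Y c : UPos A n E).claim = UPos.claim (s (emb (x n) Y c))
      rw [eq_of_low (b := emb (x n) Y c) (b' := emb (x n) ∅ none) hl.le rfl, hclaim hn]
      exact emb_claim (by omega)
    · exact (isChild_claim hE h1 (by omega)).trans (isChild_claim hE h2 (by omega)).symm
  · rcases lt_trichotomy n (k + 1) with h | rfl | h
    · exact (UPos.chal_low _ (hl'.trans_le (by omega))).trans
        (UPos.chal_low _ (hl2.trans_le (by omega))).symm
    · have : (emb (x (k + 1)) Y c : UPos A k E) = emb (x (k + 1)) Y none := by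
        refine UPos.ext rfl rfl ?_
        rw [UPos.chal_low _ (by change A.lvl (x (k + 1)) ≤ _; omega), emb_chal_none]
      change (emb (x (k + 1 + 1)) Y c : UPos A k E).chal = UPos.chal (s (emb (x (k + 1)) Y c))
      rw [this, hchal hn]
      exact emb_chal (by omega) fun v hv => ⟨(hc v hv).1, (hc v hv).2.1,
          hx.comparable (hc v hv).2.2 _⟩
    · exact (isChild_chal hE h1 (by omega)).trans (isChild_chal hE h2 (by omega)).symm

theorem status_emb_some {x : ℕ → A.Pos} (hx : A.IsBranch x) {Y : Set A.Pos} {u : A.Pos}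
    (hu : u ∈ exits A k E ∧ u ∈ Y ∧ x (A.lvl u) = u) (n : ℕ) :
    (arena hE P).status (emb (x n) Y (some u) : UPos A k E) = A.status (x n) := by
  change (if (emb (x n) Y (some u) : UPos A k E).chal = none then
    accStatus k E P _ (x n) else A.status (x n)) = _
  split_ifs with h
  · refine accStatus_low ?_
    by_contra hl
    rw [emb_chal (by omega)] at h
    · cases h
    · rintro v ⟨⟩
      exact ⟨hu.1, hu.2.1, hx.comparable hu.2.2 n⟩
  · rfl

/-- Without challenge, a play is lost as soon as it reaches an exit, by `P` if the exit has not been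
announced and by the opponent if it has been. -/
theorem status_emb_none {p : A.Pos} {Y : Set A.Pos} {i : Player}
    (h : ∀ u ∈ exits A k E, IsPrefix u p → (i = P ∧ u ∉ Y) ∨ (i = P.other ∧ u ∈ Y)) :
    (arena hE P).status (emb p Y none : UPos A k E) = some i ∨
      (arena hE P).status (emb p Y none : UPos A k E) = A.status p := by
  change (if (emb p Y none : UPos A k E).chal = none then
    accStatus k E P (emb p Y none : UPos A k E).claim p else A.status p) = _ ∨
    (if (emb p Y none : UPos A k E).chal = none then
    accStatus k E P (emb p Y none : UPos A k E).claim p else A.status p) = _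
  rw [if_pos emb_chal_none]
  rcases Nat.lt_or_ge k (A.lvl p) with hl | hl
  · rw [emb_claim hl]
    by_cases hex : ∃ u ∈ exits A k E, IsPrefix u p
    · obtain ⟨u, hu, hup⟩ := hex
      left
      rcases h u hu hup with ⟨rfl, huY⟩ | ⟨rfl, huY⟩
      · rw [accStatus, if_neg, if_pos ⟨u, hu, hup⟩]
        rintro ⟨v, hv, hvp, hvY⟩
        obtain rfl := exit_unique hE hu hv hup hvp
        exact huY hvY
      · rw [accStatus, if_pos ⟨u, hu, hup, huY⟩]
    · right
      rw [accStatus, if_neg fun ⟨u, hu, hup, _⟩ => hex ⟨u, hu, hup⟩, if_neg hex]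
  · exact Or.inr (accStatus_low (by omega))

/-- Plays by a transferred strategy of `P` are shadowed. -/
theorem lift_claimant (hP : P.ToMove k) {s : (arena hE P (k := k)).Strat} {x : ℕ → A.Pos}
    (hx : A.IsBranch x) (hxs : A.FollowsFrom P (transfer hE P s) 0 x) :
    ∃ y : ℕ → UPos A k E, (arena hE P).IsBranch y ∧ (arena hE P).FollowsFrom P s 0 y ∧
      ∀ n, (arena hE P).status (y n) = some P ∨
        ((y n).pos = x n ∧ (arena hE P).status (y n) = A.status (x n)) := by
  have hnP : ¬ P.ToMove (k + 1) := by
    rw [Player.toMove_succ, Player.toMove_other]; exact not_not_intro hP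
  set Y : Set A.Pos := UPos.claim (s (emb (x k) ∅ none)) with hY
  have hmove : ∀ n, P.ToMove n → UPos.pos (s (claimantSim Y (x n))) = x (n + 1) := by
    intro n hn
    rw [hxs n (Nat.zero_le _) hn]
    change _ = UPos.pos (s (sim hE P s (x n)))
    rw [sim, if_pos rfl]
    rcases Nat.lt_or_ge n k with h | h
    · have hl := hx.lvl_eq n
      rw [eq_of_low (b := claimantSim Y (x n)) (b' := claimantSim (claimOf hE s (x n)) (x n))
        (by change A.lvl (x n) ≤ k; omega) rfl]
    · obtain ⟨j, rfl⟩ := Nat.exists_eq_add_of_le h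
      rw [claimOf, hx.lvl_eq, Nat.add_sub_cancel_left, hx.iterate_par]
  by_cases hex : ∃ u, u ∈ exits A k E ∧ u ∈ Y ∧ x (A.lvl u) = u
  · obtain ⟨u, hu, huY, hux⟩ := hex
    have hc : ∀ v, some u = some v → v ∈ exits A k E ∧ v ∈ Y ∧ x (A.lvl v) = v := by
      rintro v ⟨⟩; exact ⟨hu, huY, hux⟩
    refine ⟨_, isBranch_emb hE hx hc, followsFrom_emb hE hx hc (fun n hn => ?_) (fun _ => hY.symm)
      (fun h => absurd h hnP), fun n => Or.inr ⟨rfl, status_emb_some hE hx ⟨hu, huY, hux⟩ n⟩⟩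
    rcases Nat.lt_or_ge n (A.lvl u) with h | h
    · rcases Nat.lt_or_ge n (k + 2) with h2 | h2
      · left
        have hnk : n ≠ k + 1 := by rintro rfl; exact hnP hn
        rw [← hmove n hn]
        have hl := hx.lvl_eq n
        rw [eq_of_low (b := claimantSim Y (x n)) (b' := emb (x n) Y (some u))
          (by change A.lvl (x n) ≤ k; omega) rfl]
      · exact Or.inr ⟨u, rfl, h, h2⟩
    · left
      rw [← hmove n hn, claimantSim_of_mem hE hu huY (hx.isPrefix_iff.2 ⟨h, hux⟩)]
  · have hc : ∀ v, none = some v → v ∈ exits A k E ∧ v ∈ Y ∧ x (A.lvl v) = v := by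
      rintro v ⟨⟩
    have hnot : ∀ n u, u ∈ exits A k E → IsPrefix u (x n) → u ∉ Y := fun n u hu hup huY =>
      hex ⟨u, hu, huY, (hx.isPrefix_iff.1 hup).2⟩
    refine ⟨_, isBranch_emb hE hx hc, followsFrom_emb hE hx hc (fun n hn => Or.inl ?_)
      (fun _ => hY.symm) (fun h => absurd h hnP), fun n => ?_⟩
    · rw [← hmove n hn, claimantSim_of_not]
      rintro ⟨u, hu, huY, hup⟩
      exact hnot n u hu hup huY
    · exact (status_emb_none hE (i := P) fun u hu hup => Or.inl ⟨rfl, hnot n u hu hup⟩).imp id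
        fun h => ⟨rfl, h⟩

/-- Plays by a transferred strategy of the opponent of `P` are shadowed. -/
theorem lift_challenger (hP : P.ToMove k) {s : (arena hE P (k := k)).Strat} {x : ℕ → A.Pos}
    (hx : A.IsBranch x) (hxs : A.FollowsFrom P.other (transfer hE P.other s) 0 x) :
    ∃ y : ℕ → UPos A k E, (arena hE P).IsBranch y ∧ (arena hE P).FollowsFrom P.other s 0 y ∧
      ∀ n, (arena hE P).status (y n) = some P.other ∨
        ((y n).pos = x n ∧ (arena hE P).status (y n) = A.status (x n)) := by
  have hnP : ¬ P.other.ToMove k := by rw [Player.toMove_other]; exact not_not_intro hP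
  set g : Set A.Pos → Option A.Pos := fun Y => UPos.chal (s (emb (x (k + 1)) Y none)) with hg
  have hg_mem : ∀ Y u, g Y = some u → u ∈ Y := by
    intro Y u h
    have hl : A.lvl (x (k + 1)) = k + 1 := hx.lvl_eq _
    have h1 := (UPos.chal_mem _ u h).2.1
    have h2 := isChild_claim hE (s.isChild (emb (x (k + 1)) Y none)) (hl.ge.trans' k.lt_succ_self)
    exact ((h2.trans (emb_claim (by omega))) ▸ h1 : u ∈ Y)
  have hmove : ∀ n, P.other.ToMove n →
      UPos.pos (s (challengerSim g (x n))) = x (n + 1) := by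
    intro n hn
    rw [hxs n (Nat.zero_le _) hn]
    change _ = UPos.pos (s (sim hE P.other s (x n)))
    rw [sim, if_neg P.other_ne]
    rcases Nat.lt_or_ge n (k + 1) with h | h
    · have hl := hx.lvl_eq n
      rw [eq_of_low (b := challengerSim g (x n)) (b' := challengerSim (chalOf hE s (x n)) (x n))
        (by rw [challengerSim_pos]; omega) (by rw [challengerSim_pos, challengerSim_pos])]
    · obtain ⟨j, rfl⟩ := Nat.exists_eq_add_of_le h
      have : chalOf hE s (x (k + 1 + j)) = g := by
        funext Y
        rw [chalOf, hx.lvl_eq, Nat.add_sub_cancel_left, hx.iterate_par]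
      rw [this]
  by_cases hex : ∃ u, u ∈ exits A k E ∧ (∃ Y, g Y = some u) ∧ x (A.lvl u) = u
  · obtain ⟨u, hu, huY, hux⟩ := hex
    obtain ⟨Y, hY, hsim⟩ := exists_challengerSim_of_mem hE hu huY
    have hc : ∀ v, some u = some v → v ∈ exits A k E ∧ v ∈ Y ∧ x (A.lvl v) = v := by
      rintro v ⟨⟩; exact ⟨hu, hg_mem _ _ hY, hux⟩
    refine ⟨_, isBranch_emb hE hx hc, followsFrom_emb hE hx hc (fun n hn => ?_)
      (fun h => absurd h hnP) (fun _ => hY),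
      fun n => Or.inr ⟨rfl, status_emb_some hE hx (hc u rfl) n⟩⟩
    have hl := hx.lvl_eq n
    rcases Nat.lt_or_ge n (A.lvl u) with h | h
    · rcases lt_trichotomy n (k + 1) with h2 | rfl | h2
      · left
        rw [← hmove n hn, eq_of_low (b := challengerSim g (x n)) (b' := emb (x n) Y (some u))
          (by rw [challengerSim_pos]; omega) (challengerSim_pos _ _)]
      · left
        -- The reply to `Y` respects the challenge of `u`, which lies on `x`.
        have h1 := s.isChild (emb (x (k + 1)) Y none)
        have h2 : (emb (x (k + 1)) Y (some u) : UPos A k E) = emb (x (k + 1)) Y none := by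
          refine UPos.ext rfl rfl ?_
          rw [UPos.chal_low _ (by change A.lvl (x (k + 1)) ≤ _; omega), emb_chal_none]
        rw [h2]
        exact Comparable.isChild_unique (p := x (k + 1)) (u := u) (by omega)
          (isChild_pos hE h1) (hx.isChild _) (UPos.chal_mem _ u hY).2.2
          (hx.comparable hux _)
      · exact Or.inr ⟨u, rfl, h, h2⟩
    · left
      rw [← hmove n hn, hsim _ (hx.isPrefix_iff.2 ⟨h, hux⟩)]
  · set Y : Set A.Pos := {u | ¬ ∃ Y, g Y = some u} with hY
    have hc : ∀ v, none = some v → v ∈ exits A k E ∧ v ∈ Y ∧ x (A.lvl v) = v := by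
      rintro v ⟨⟩
    have hmem : ∀ n u, u ∈ exits A k E → IsPrefix u (x n) → u ∈ Y := fun n u hu hup huY =>
      hex ⟨u, hu, huY, (hx.isPrefix_iff.1 hup).2⟩
    refine ⟨_, isBranch_emb hE hx hc, followsFrom_emb hE hx hc (fun n hn => Or.inl ?_)
      (fun h => absurd h hnP) (fun _ => ?_), fun n => ?_⟩
    · rw [← hmove n hn, challengerSim_of_not]
      rintro ⟨u, hu, hup, huY⟩
      exact hmem n u hu hup huY
    · -- A challenge in reply to `Y` would be of an element of `Y`.
      change g Y = none
      rw [Option.eq_none_iff_forall_ne_some]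
      intro u hu
      exact hg_mem Y u hu ⟨Y, hu⟩
    · exact (status_emb_none hE (i := P.other) fun u hu hup =>
        Or.inr ⟨rfl, hmem n u hu hup⟩).imp id fun h => ⟨rfl, h⟩

/-- The unravelled game covers the given one. -/
noncomputable def cover (hP : P.ToMove k) : Cover k (arena hE P (k := k)) A where
  toHom := hom hE P
  inj b b' h _ e := eq_of_low h e
  surj a _ := ⟨emb a ∅ none, rfl⟩
  status_eq b h := by
    change A.lvl b.pos ≤ k at h
    change (if b.chal = none then accStatus k E P b.claim b.pos else A.status b.pos) = _
    rw [if_pos (b.chal_low (by omega)), accStatus_low (by omega)]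
    rfl
  strat := transfer hE
  strat_low i s b h := by
    change UPos.pos (s (sim hE i s b.pos)) = UPos.pos (s b)
    rw [eq_of_low (b := b) (b' := sim hE i s b.pos) (Nat.le_of_lt h) (sim_pos hE _ _ _).symm]
    rw [sim_pos]
  strat_local i s s' n h a ha := by
    change UPos.pos (s (sim hE i s a)) = UPos.pos (s' (sim hE i s' a))
    rw [sim_congr hE i (s' := s') fun b hb => h b (le_trans hb ha)]
    refine congrArg UPos.pos (h _ ?_)
    change A.lvl (UPos.pos _) ≤ n
    rwa [sim_pos]
  lift i s x hx hxs := by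
    rcases P.eq_or_eq_other i with rfl | rfl
    · exact lift_claimant hE hP hx hxs
    · exact lift_challenger hE hP hx hxs

/-- In the unravelled game, the set `E` is reached, in the absence of taboos, if and only if there
has been a challenge. -/
theorem exists_mem_iff {y : ℕ → UPos A k E} (hy : (arena hE P).IsAlive y) :
    (∃ n, (y n).pos ∈ E) ↔ (y (k + 2)).chal ≠ none := by
  have hx := (hom hE P).map_isBranch hy.toIsBranch
  change A.IsBranch (fun n => (y n).pos) at hx
  have hchal : ∀ j, (y (k + 2 + j)).chal = (y (k + 2)).chal := by
    intro j
    induction j with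
    | zero => rfl
    | succ j ih =>
      rw [← ih]
      exact isChild_chal hE (hy.isChild _) (by rw [hx.lvl_eq (k + 2 + j)]; omega)
  constructor
  · rintro ⟨n, hn⟩ hnone
    have hmono : ∀ m, n ≤ m → (y m).pos ∈ E := by
      intro m hm
      induction m, hm using Nat.le_induction with
      | base => exact hn
      | succ m _ ih => exact hE _ _ (hx.isChild m) ih
    have hex : ∃ j, (y (k + 2 + j)).pos ∈ E := ⟨n, hmono _ (by omega)⟩
    classical
    obtain ⟨j, hj, hmin⟩ : ∃ j, (y (k + 2 + j)).pos ∈ E ∧ ∀ i < j, (y (k + 2 + i)).pos ∉ E :=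
      ⟨Nat.find hex, Nat.find_spec hex, fun i hi => Nat.find_min hex hi⟩
    have hst := hy.status (k + 2 + j)
    change (if (y (k + 2 + j)).chal = none then accStatus k E P _ (y (k + 2 + j)).pos
      else _) = none at hst
    rw [if_pos ((hchal j).trans hnone)] at hst
    obtain ⟨h1, h2⟩ := accStatus_none hst
    have hl := hx.lvl_eq (k + 2 + j)
    refine h2 _ ⟨hj, by omega, ?_, h1⟩ (IsPrefix.refl _)
    cases j with
    | zero => exact Or.inl hl
    | succ j =>
      right
      have := (hx.isChild (k + 2 + j)).2
      rw [← add_assoc, this]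
      exact hmin j (Nat.lt_succ_self _)
  · intro h
    obtain ⟨u, hu⟩ := Option.ne_none_iff_exists'.1 h
    have hl : k + 2 ≤ A.lvl u := (UPos.chal_mem _ u hu).1.2.1
    obtain ⟨j, hj⟩ := Nat.exists_eq_add_of_le hl
    refine ⟨k + 2 + j, ?_⟩
    obtain ⟨h1, -, h3⟩ := UPos.chal_mem _ u ((hchal j).trans hu)
    have hl' := hx.lvl_eq (k + 2 + j)
    rw [Comparable, hl', ← hj, Nat.sub_self] at h3
    change (y (A.lvl u)).pos = u at h3
    rw [← hj, h3]
    exact h1.1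

end Unravel

/-- Every set that is open among the plays without taboos becomes clopen in some covering. -/
theorem exists_cover_of_isOpenOn {A : Arena.{u}} {W : Set (ℕ → A.Pos)} (hW : A.IsOpenOn W)
    (k : ℕ) : ∃ (B : Arena.{u}) (c : Cover k B A),
      B.IsClopenOn {y | (fun n => c.toFun (y n)) ∈ W} := by
  obtain ⟨P, hP⟩ := Player.exists_toMove k
  -- The positions such that all plays through them without taboos are in `W`.
  let E : Set A.Pos := {p | ∀ x, A.IsAlive x → x (A.lvl p) = p → x ∈ W}
  have hE : ∀ p q, A.IsChild q p → p ∈ E → q ∈ E := by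
    intro p q hqp hp x hx hxq
    refine hp x hx ?_
    rw [hqp.1] at hxq
    exact (hx.isChild _).2.symm.trans ((congrArg A.par hxq).trans hqp.2)
  have hWE : ∀ x, A.IsAlive x → (x ∈ W ↔ ∃ n, x n ∈ E) := by
    intro x hx
    constructor
    · intro h
      obtain ⟨n, hn⟩ := hW x hx h
      exact ⟨n, fun y hy hyn => hn y hy (by rwa [hx.lvl_eq] at hyn)⟩
    · rintro ⟨n, hn⟩
      exact hn x hx (by rw [hx.lvl_eq])
  refine ⟨Unravel.arena hE P, Unravel.cover hE hP, fun x hx => ⟨k + 2, fun y hy hyx => ?_⟩⟩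
  have h1 := fun z (hz : (Unravel.arena hE P (k := k)).IsAlive z) =>
    (hWE _ ((Unravel.hom hE P).map_isAlive hz)).trans (Unravel.exists_mem_iff hE hz)
  refine (h1 y hy).trans (Iff.trans ?_ (h1 x hx).symm)
  rw [hyx]

/-! ### Unravelling Borel sets -/

theorem IsClopenOn.isOpenOn {A : Arena.{u}} {W : Set (ℕ → A.Pos)} (h : A.IsClopenOn W) :
    A.IsOpenOn W := by
  intro x hx hxW
  obtain ⟨n, hn⟩ := h x hx
  exact ⟨n, fun y hy hyx => (hn y hy hyx).2 hxW⟩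

theorem IsClopenOn.comap {A B : Arena.{u}} {W : Set (ℕ → A.Pos)} (h : A.IsClopenOn W)
    (f : Hom B A) : B.IsClopenOn {y | (fun n => f.toFun (y n)) ∈ W} := by
  intro x hx
  obtain ⟨n, hn⟩ := h _ (f.map_isAlive hx)
  exact ⟨n, fun y hy hyx => hn _ (f.map_isAlive hy) (congrArg f.toFun hyx)⟩

theorem IsOpenOn.comap {A B : Arena.{u}} {W : Set (ℕ → A.Pos)} (h : A.IsOpenOn W)
    (f : Hom B A) : B.IsOpenOn {y | (fun n => f.toFun (y n)) ∈ W} := by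
  intro x hx hxW
  obtain ⟨n, hn⟩ := h _ (f.map_isAlive hx) hxW
  exact ⟨n, fun y hy hyx => hn _ (f.map_isAlive hy) (congrArg f.toFun hyx)⟩

theorem isOpenOn_iUnion {A : Arena.{u}} {W : ℕ → Set (ℕ → A.Pos)} (h : ∀ m, A.IsOpenOn (W m)) :
    A.IsOpenOn (⋃ m, W m) := by
  intro x hx hxW
  obtain ⟨m, hm⟩ := Set.mem_iUnion.1 hxW
  obtain ⟨n, hn⟩ := h m x hx hm
  exact ⟨n, fun y hy hyx => Set.mem_iUnion.2 ⟨m, hn y hy hyx⟩⟩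

/-- Pulled back to any arena over `A`, the set `W` becomes clopen in some `k`-covering of that
arena, for every `k`. -/
def Unravellable (A : Arena.{u}) (W : Set (ℕ → A.Pos)) : Prop :=
  ∀ (B : Arena.{u}) (f : Hom B A) (k : ℕ), ∃ (C : Arena.{u}) (c : Cover k C B),
    C.IsClopenOn {y | (fun n => f.toFun (c.toFun (y n))) ∈ W}

theorem IsOpenOn.unravellable {A : Arena.{u}} {W : Set (ℕ → A.Pos)} (h : A.IsOpenOn W) :
    A.Unravellable W :=
  fun _ f k => exists_cover_of_isOpenOn (h.comap f) k

theorem Unravellable.congr {A : Arena.{u}} {W W' : Set (ℕ → A.Pos)} (h : A.Unravellable W)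
    (hW : ∀ x, A.IsAlive x → (x ∈ W' ↔ x ∈ W)) : A.Unravellable W' := by
  intro B f k
  obtain ⟨C, c, hc⟩ := h B f k
  refine ⟨C, c, fun x hx => ?_⟩
  obtain ⟨n, hn⟩ := hc x hx
  have key := fun z (hz : C.IsAlive z) => hW _ ((f.comp c.toHom).map_isAlive hz)
  exact ⟨n, fun y hy hyx => (key y hy).trans ((hn y hy hyx).trans (key x hx).symm)⟩

theorem Unravellable.compl {A : Arena.{u}} {W : Set (ℕ → A.Pos)} (h : A.Unravellable W) :
    A.Unravellable Wᶜ := by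
  intro B f k
  obtain ⟨C, c, hc⟩ := h B f k
  refine ⟨C, c, fun x hx => ?_⟩
  obtain ⟨n, hn⟩ := hc x hx
  exact ⟨n, fun y hy hyx => not_congr (hn y hy hyx)⟩

/-- The sets are made clopen one after the other; in the inverse limit all of them are clopen, so
that their union is open. -/
theorem Unravellable.iUnion {A : Arena.{u}} {W : ℕ → Set (ℕ → A.Pos)}
    (h : ∀ m, A.Unravellable (W m)) : A.Unravellable (⋃ m, W m) := by
  intro B f k
  choose C c hc using fun m (S : Σ B : Arena.{u}, Hom B A) => h m S.1 S.2 (k + m)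
  let S : ℕ → Σ B : Arena.{u}, Hom B A :=
    fun m => Nat.rec ⟨B, f⟩ (fun m S => ⟨C m S, S.2.comp (c m S).toHom⟩) m
  let d : ∀ m, Cover (k + m) (S (m + 1)).1 (S m).1 := fun m => c m (S m)
  have hK : Monotone (fun m => k + m) := fun a b h => Nat.add_le_add_left h k
  have hK' : ∀ m, m ≤ k + m := fun m => Nat.le_add_left m k
  let L := limit (A := fun m => (S m).1) d hK hK'
  have hproj : ∀ m (p : Thread (A := fun m => (S m).1) d),
      (S m).2.toFun (p.seq m) = f.toFun (p.seq 0) := by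
    intro m p
    induction m with
    | zero => rfl
    | succ m ih =>
      rw [← ih, ← p.map_seq m]
      rfl
  have hclopen : ∀ m, L.IsClopenOn
      {y | (fun n => f.toFun (Thread.seq (y n) 0)) ∈ W m} := by
    intro m
    have h1 := (hc m (S m)).comap (limitHom (A := fun m => (S m).1) (c := d) hK hK' (m + 1))
    have h2 : ∀ w : ℕ → Thread (A := fun m => (S m).1) d,
        ((fun n => (S m).2.toFun ((c m (S m)).toFun ((w n).seq (m + 1)))) ∈ W m ↔
          (fun n => f.toFun ((w n).seq 0)) ∈ W m) := fun w =>
      iff_of_eq (congrArg (· ∈ W m) (funext fun n => hproj (m + 1) (w n)))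
    intro x hx
    obtain ⟨n, hn⟩ := h1 x hx
    exact ⟨n, fun y hy hyx => (h2 y).symm.trans ((hn y hy hyx).trans (h2 x))⟩
  have hopen : L.IsOpenOn {y | (fun n => f.toFun (Thread.seq (y n) 0)) ∈ ⋃ m, W m} := by
    have h := isOpenOn_iUnion fun m => (hclopen m).isOpenOn
    rwa [show (⋃ m, {y : ℕ → L.Pos | (fun n => f.toFun (Thread.seq (y n) 0)) ∈ W m}) =
      {y | (fun n => f.toFun (Thread.seq (y n) 0)) ∈ ⋃ m, W m} by ext; simp] at h
  obtain ⟨D, e, he⟩ := exists_cover_of_isOpenOn hopen k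
  exact ⟨D, (limitCover (A := fun m => (S m).1) d hK hK').comp e, he⟩

/-! ### Determinacy of clopen games -/

/-- Player `i` wins the play `x` of the game in which `W` is the set of plays without taboos that
are won by `I`. -/
def Won (A : Arena.{u}) (W : Set (ℕ → A.Pos)) (i : Player) (x : ℕ → A.Pos) : Prop :=
  (∃ n, A.status (x n) = some i.other) ∨ ((∀ n, A.status (x n) = none) ∧ (x ∈ W ↔ i = Player.I))

/-- Player `i` has a winning strategy in the game starting at `p`. -/
def WinsFrom (A : Arena.{u}) (W : Set (ℕ → A.Pos)) (i : Player) (p : A.Pos) : Prop :=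
  ∃ s : A.Strat, ∀ x, A.IsBranch x → x (A.lvl p) = p → A.FollowsFrom i s (A.lvl p) x → A.Won W i x

section Clopen

variable {A : Arena.{u}} {W : Set (ℕ → A.Pos)} {i : Player} {p q : A.Pos}

theorem Won.eq_other_of_status {x : ℕ → A.Pos} (hx : A.IsBranch x) (h : A.Won W i x) {n : ℕ}
    {j : Player} (hj : A.status (x n) = some j) : j = i.other := by
  rcases h with ⟨m, hm⟩ | ⟨h, -⟩
  · have h1 := hx.status_of_le hj (le_max_left n m)
    have h2 := hx.status_of_le hm (le_max_right n m)
    exact Option.some.inj (h1.symm.trans h2)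
  · rw [h n] at hj; cases hj

theorem winsFrom_of_status (h : A.status p = some i.other) : A.WinsFrom W i p := by
  obtain ⟨s⟩ := (inferInstance : Nonempty A.Strat)
  exact ⟨s, fun x _ hxp _ => Or.inl ⟨A.lvl p, by rw [hxp, h]⟩⟩

theorem winsFrom_of_isChild (hi : i.ToMove (A.lvl p)) (hq : A.IsChild q p)
    (h : A.WinsFrom W i q) : A.WinsFrom W i p := by
  classical
  obtain ⟨s, hs⟩ := h
  refine ⟨⟨fun r => if r = p then q else s r, fun r => ?_⟩, fun x hx hxp hxs => ?_⟩
  · split_ifs with h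
    · rwa [h]
    · exact s.isChild r
  · have hxq : x (A.lvl q) = q := by
      rw [hq.1, hxs _ le_rfl hi, hxp]
      exact if_pos rfl
    refine hs x hx hxq fun n hn hin => ?_
    rw [hxs n (by rw [hq.1] at hn; omega) hin]
    refine if_neg fun h => ?_
    have := congrArg A.lvl h
    rw [hx.lvl_eq] at this
    rw [hq.1] at hn
    omega

theorem winsFrom_of_forall_isChild (h : ∀ q, A.IsChild q p → A.WinsFrom W i q) :
    A.WinsFrom W i p := by
  classical
  choose! s hs using h
  obtain ⟨d⟩ := (inferInstance : Nonempty A.Strat)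
  -- After the first move, play by the strategy for the position it has led to.
  refine ⟨⟨fun r => s (A.par^[A.lvl r - (A.lvl p + 1)] r) r, fun r => (s _).isChild r⟩,
    fun x hx hxp hxs => ?_⟩
  have hq : A.IsChild (x (A.lvl p + 1)) p := by
    have := hx.isChild (A.lvl p)
    rwa [hxp] at this
  refine hs _ hq x hx (by rw [hx.lvl_eq]) fun n hn hin => ?_
  rw [hx.lvl_eq] at hn
  rw [hxs n (by omega) hin]
  change s (A.par^[A.lvl (x n) - (A.lvl p + 1)] (x n)) (x n) = _
  obtain ⟨j, rfl⟩ := Nat.exists_eq_add_of_le hn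
  rw [hx.lvl_eq, Nat.add_sub_cancel_left, hx.iterate_par]

/-- From a position where `i` has no winning strategy, the opponent can keep to such positions. -/
theorem exists_strat_not_winsFrom (W : Set (ℕ → A.Pos)) (i : Player) : ∃ t : A.Strat,
    ∀ x, A.IsBranch x → ∀ N, ¬ A.WinsFrom W i (x N) → A.FollowsFrom i.other t N x →
      ∀ n, N ≤ n → ¬ A.WinsFrom W i (x n) := by
  have key : ∀ r, ∃ q, A.IsChild q r ∧
      (i.other.ToMove (A.lvl r) → ¬ A.WinsFrom W i r → ¬ A.WinsFrom W i q) := by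
    intro r
    by_contra! hcon
    obtain ⟨q, hq⟩ := A.exists_child r
    exact (hcon q hq).2.1 (winsFrom_of_forall_isChild fun q hq => (hcon q hq).2.2)
  choose t ht ht' using key
  refine ⟨⟨t, ht⟩, fun x hx N hN hxt n hn => ?_⟩
  induction n, hn using Nat.le_induction with
  | base => exact hN
  | succ n hn ih =>
    by_cases hi : i.other.ToMove n
    · rw [hxt n hn hi]
      exact ht' _ (by rwa [hx.lvl_eq]) ih
    · rw [Player.toMove_other, not_not] at hi
      exact fun h => ih (winsFrom_of_isChild (by rwa [hx.lvl_eq]) (hx.isChild n) h)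

/-- Clopen games are determined, even with taboos. From a position where neither player wins,
they could play on through such positions forever. This play meets no taboo, so from some position
on all plays without taboos are won by the same player `i`; but then `i` wins by avoiding
the positions in which the opponent wins, in particular those in which `i` has run into a taboo. -/
theorem IsClopenOn.winsFrom (hW : A.IsClopenOn W) (p : A.Pos) : ∃ i, A.WinsFrom W i p := by
  by_contra! hp
  have key : ∀ r, ∃ q, A.IsChild q r ∧ ((∀ i, ¬ A.WinsFrom W i r) → ∀ i, ¬ A.WinsFrom W i q) := by
    intro r
    by_cases hr : ∀ i, ¬ A.WinsFrom W i r
    · obtain ⟨i, hi⟩ := Player.exists_toMove (A.lvl r)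
      have : ∃ q, A.IsChild q r ∧ ¬ A.WinsFrom W i.other q := by
        by_contra! hcon
        exact hr i.other (winsFrom_of_forall_isChild hcon)
      obtain ⟨q, hq, hqi⟩ := this
      refine ⟨q, hq, fun _ j => ?_⟩
      rcases i.eq_or_eq_other j with rfl | rfl
      · exact fun h => hr _ (winsFrom_of_isChild hi hq h)
      · exact hqi
    · obtain ⟨q, hq⟩ := A.exists_child r
      exact ⟨q, hq, fun h => absurd h hr⟩
  choose t ht ht' using key
  obtain ⟨z, hz, hzp⟩ := exists_branch_through p
  obtain ⟨x, hx, hxz, hxt⟩ := exists_branch_extending hz.lvl_zero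
    (fun n (_ : n < A.lvl p) => hz.isChild n) ⟨t, ht⟩
  have hund : ∀ n, A.lvl p ≤ n → ∀ i, ¬ A.WinsFrom W i (x n) := by
    intro n hn
    induction n, hn using Nat.le_induction with
    | base => rw [hxz _ le_rfl, hzp]; exact hp
    | succ n hn ih => rw [hxt n hn]; exact ht' _ ih
  have hal : A.IsAlive x := by
    refine ⟨hx, fun n => ?_⟩
    rw [Option.eq_none_iff_forall_ne_some]
    intro j hj
    refine hund _ (le_max_right n (A.lvl p)) j.other (winsFrom_of_status ?_)
    rw [Player.other_other]
    exact hx.status_of_le hj (le_max_left _ _)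
  obtain ⟨n, hn⟩ := hW x hal
  obtain ⟨i, hi⟩ : ∃ i, x ∈ W ↔ i = Player.I := by
    by_cases h : x ∈ W
    exacts [⟨Player.I, by simp [h]⟩, ⟨Player.II, by simp [h]⟩]
  set m := max n (A.lvl p)
  obtain ⟨s, hs⟩ := exists_strat_not_winsFrom W i.other
  refine hund m (le_max_right _ _) i ⟨s, fun y hy hyx hys => ?_⟩
  rw [hx.lvl_eq] at hyx hys
  rw [Player.other_other] at hs
  have hstay := hs y hy m (by rw [hyx]; exact hund m (le_max_right _ _) _) hys
  by_cases hlost : ∃ l, A.status (y l) = some i.other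
  · exact Or.inl hlost
  · have hya : A.IsAlive y := by
      refine ⟨hy, fun l => ?_⟩
      rw [Option.eq_none_iff_forall_ne_some]
      intro j hj
      rcases i.eq_or_eq_other j with rfl | rfl
      · refine hstay _ (le_max_right l m) (winsFrom_of_status ?_)
        rw [Player.other_other]
        exact hy.status_of_le hj (le_max_left _ _)
      · exact hlost ⟨l, hj⟩
    exact Or.inr ⟨hya.status, (hn y hya (hy.eq_of_le hx hyx (le_max_left _ _))).trans hi⟩

end Clopen

/-- A game on an arena with a single initial position is determined if its payoff set can be
unravelled. -/
theorem Unravellable.determined {A : Arena.{u}} {W : Set (ℕ → A.Pos)} (h : A.Unravellable W)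
    (r : A.Pos) (hr : ∀ p, A.lvl p = 0 ↔ p = r) :
    ∃ (i : Player) (s : A.Strat), ∀ x, A.IsBranch x → A.FollowsFrom i s 0 x → A.Won W i x := by
  obtain ⟨B, c, hB⟩ := h A (Hom.id A) 0
  have hr0 : A.lvl r = 0 := (hr r).2 rfl
  obtain ⟨b, rfl⟩ := c.surj r hr0.le
  have hb : B.lvl b = 0 := by rw [← c.lvl_toFun, hr0]
  obtain ⟨i, s, hs⟩ := hB.winsFrom b
  refine ⟨i, c.strat i s, fun x hx hxs => ?_⟩
  obtain ⟨y, hy, hys, hyx⟩ := c.lift i s x hx hxs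
  have hy0 : y (B.lvl b) = b := by
    rw [hb]
    refine c.inj _ _ hy.lvl_zero.le hb.le ((hr _).1 ?_)
    rw [c.lvl_toFun, hy.lvl_zero]
  rcases hs y hy hy0 (by rwa [hb]) with ⟨n, hn⟩ | ⟨hn, hW⟩
  · refine Or.inl ⟨n, ?_⟩
    rcases hyx n with h | h
    · exact absurd (Option.some.inj (hn.symm.trans h)) i.other_ne
    · rw [← h.2, hn]
  · have hyx' := fun n => (hyx n).resolve_left (by rw [hn n]; simp)
    obtain rfl : (fun n => c.toFun (y n)) = x := funext fun n => (hyx' n).1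
    exact Or.inr ⟨fun n => by rw [← (hyx' n).2, hn], hW⟩

end Arena

open Arena

/-! ### Game trees with taboos as arenas -/

section Tree

variable {X : Type u}

theorem not_isTerminal_iff {T : Descriptive.tree X} {p : List X} (hp : p ∈ T) :
    ¬ IsTerminal T p ↔ ∃ a, p ++ [a] ∈ T := by
  constructor
  · intro h
    obtain ⟨q, hq, ⟨t, rfl⟩, hne⟩ : ∃ q ∈ T, p <+: q ∧ p ≠ q := by
      by_contra hcon
      exact h ⟨hp, hcon⟩
    cases t with
    | nil => simp at hne
    | cons a t =>
      refine ⟨a, Descriptive.Tree.mem_of_append (y := t) ?_⟩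
      simpa using hq
  · rintro ⟨a, ha⟩ ⟨-, h⟩
    exact h ⟨_, ha, List.prefix_append _ _, by simp⟩

theorem eq_of_isTerminal {T : Descriptive.tree X} {p q : List X} (hp : IsTerminal T p)
    (hq : q ∈ T) (h : p <+: q) : q = p := by
  by_contra hne
  exact hp.2 ⟨q, hq, h, fun h => hne h.symm⟩

/-- The first `n` moves of an infinite sequence. -/
def initSeq (b : ℕ → X) (n : ℕ) : List X := (List.range n).map b

@[simp] theorem length_initSeq (b : ℕ → X) (n : ℕ) : (initSeq b n).length = n := by
  simp [initSeq]

theorem initSeq_succ (b : ℕ → X) (n : ℕ) : initSeq b (n + 1) = initSeq b n ++ [b n] := by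
  simp [initSeq, List.range_succ]

theorem initSeq_prefix (b : ℕ → X) {m n : ℕ} (h : m ≤ n) : initSeq b m <+: initSeq b n := by
  induction n, h using Nat.le_induction with
  | base => exact List.prefix_rfl
  | succ n _ ih => exact ih.trans (by rw [initSeq_succ]; exact List.prefix_append _ _)

theorem isInitSeg_inr_iff {p : List X} {b : ℕ → X} :
    IsInitSeg p (Sum.inr b) ↔ p = initSeq b p.length := by
  constructor
  · intro h
    refine List.ext_getElem (by simp) fun n h1 h2 => ?_
    rw [h n h1]
    simp [initSeq]
  · intro h n hn
    have h1 : n < (initSeq b p.length).length := by simpa using hn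
    have h2 : p[n] = (initSeq b p.length)[n] := by congr 1
    rw [h2]
    simp [initSeq]

theorem initSeq_injective {b b' : ℕ → X} (h : ∀ n, initSeq b n = initSeq b' n) : b = b' := by
  funext n
  have := h (n + 1)
  rw [initSeq_succ, initSeq_succ, h n] at this
  simpa using this

theorem isPlay_inr_iff {T : Descriptive.tree X} {b : ℕ → X} :
    IsPlay T (Sum.inr b) ↔ ∀ n, initSeq b n ∈ T := by
  constructor
  · intro h n
    exact h _ (isInitSeg_inr_iff.2 (by simp))
  · intro h p hp
    rw [isInitSeg_inr_iff.1 hp]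
    exact h _

variable (T : TabooTree X)

/-- The positions of the arena of a game tree with taboos: those of the tree and, at terminal ones,
any number `pad` of further idle moves. -/
@[ext]
structure PaddedPos : Type u where
  seq : List X
  pad : ℕ
  mem : seq ∈ T.tree
  terminal : pad ≠ 0 → IsTerminal T.tree seq

variable {T}

open Classical in
/-- The player for whom the position is taboo, at a terminal position. -/
noncomputable def tabooStatus (T : TabooTree X) (p : List X) : Option Player :=
  if h : IsTerminal T.tree p then
    if (⟨Sum.inl p, h⟩ : Play T.tree) ∈ T.tabooI then some Player.I else some Player.II
  else none

theorem tabooStatus_eq_none {p : List X} : tabooStatus T p = none ↔ ¬ IsTerminal T.tree p := by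
  unfold tabooStatus
  split_ifs with h h' <;> simp [h]

/-- A game tree with taboos as an arena. -/
noncomputable def treeArena (T : TabooTree X) : Arena.{u} where
  Pos := PaddedPos T
  lvl p := p.seq.length + p.pad
  par p :=
    { seq := if p.pad = 0 then p.seq.dropLast else p.seq
      pad := p.pad - 1
      mem := by
        split_ifs
        exacts [Descriptive.Tree.mem_of_prefix p.seq.dropLast_prefix p.mem, p.mem]
      terminal := fun h => by
        rw [if_neg (by omega)]
        exact p.terminal (by omega) }
  status p := tabooStatus T p.seq
  lvl_par p := by
    dsimp only
    split_ifs with h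
    · rw [List.length_dropLast]; omega
    · omega
  exists_child p := by
    by_cases h : IsTerminal T.tree p.seq
    · exact ⟨⟨p.seq, p.pad + 1, p.mem, fun _ => h⟩, rfl, rfl⟩
    · obtain ⟨a, ha⟩ := (not_isTerminal_iff p.mem).1 h
      have hp : p.pad = 0 := by
        by_contra hp
        exact h (p.terminal hp)
      refine ⟨⟨p.seq ++ [a], 0, ha, by simp⟩, by simp [hp], ?_⟩
      exact PaddedPos.ext (by simp) hp.symm
  status_par p i h := by
    dsimp only at h
    split_ifs at h with hp
    · have ht : IsTerminal T.tree p.seq.dropLast := by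
        by_contra ht
        rw [tabooStatus_eq_none.2 ht] at h
        cases h
      rwa [eq_of_isTerminal ht p.mem p.seq.dropLast_prefix]
    · exact h

theorem isChild_of_isTerminal {p q : PaddedPos T} (h : (treeArena T).IsChild q p)
    (hp : IsTerminal T.tree p.seq) : q.seq = p.seq ∧ q.pad = p.pad + 1 := by
  have h1 : q.seq.length + q.pad = p.seq.length + p.pad + 1 := h.1
  have h2 : (if q.pad = 0 then q.seq.dropLast else q.seq) = p.seq := congrArg PaddedPos.seq h.2
  have h3 : q.seq = p.seq := by
    refine eq_of_isTerminal hp q.mem ?_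
    rw [← h2]
    split_ifs
    exacts [List.dropLast_prefix _, List.prefix_rfl]
  rw [h3] at h1
  exact ⟨h3, by omega⟩

theorem isChild_of_not_isTerminal {p q : PaddedPos T} (h : (treeArena T).IsChild q p)
    (hp : ¬ IsTerminal T.tree p.seq) : (∃ a, q.seq = p.seq ++ [a]) ∧ q.pad = 0 := by
  have h1 : q.seq.length + q.pad = p.seq.length + p.pad + 1 := h.1
  have h2 : (if q.pad = 0 then q.seq.dropLast else q.seq) = p.seq := congrArg PaddedPos.seq h.2
  have h3 : q.pad = 0 := by
    by_contra hq
    rw [if_neg hq] at h2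
    exact hp (h2 ▸ q.terminal hq)
  rw [if_pos h3] at h2
  have h4 : q.seq ≠ [] := by
    intro h4
    rw [h3, h4] at h1
    simp at h1
  exact ⟨⟨q.seq.getLast h4, h2 ▸ (List.dropLast_append_getLast h4).symm⟩, h3⟩

theorem exists_initSeq_of_isAlive {z : ℕ → PaddedPos T} (hz : (treeArena T).IsAlive z) :
    ∃ b, ∀ n, (z n).seq = initSeq b n := by
  have h : ∀ n, ∃ a, (z (n + 1)).seq = (z n).seq ++ [a] := fun n =>
    (isChild_of_not_isTerminal (hz.isChild n) (tabooStatus_eq_none.1 (hz.status n))).1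
  choose b hb using h
  refine ⟨b, fun n => ?_⟩
  induction n with
  | zero =>
    have h0 : (z 0).seq.length + (z 0).pad = 0 := hz.lvl_zero
    exact List.eq_nil_of_length_eq_zero (by omega)
  | succ n ih => rw [hb, ih, initSeq_succ]

/-- The plays of the arena that come from the elements of a set of infinite plays. -/
def encode (A : Set (infinitePlays T.tree)) : Set (ℕ → PaddedPos T) :=
  {z | ∃ x ∈ A, ∃ b, x.1.1 = Sum.inr b ∧ ∀ n, (z n).seq = initSeq b n}

theorem mem_encode {A : Set (infinitePlays T.tree)} {z : ℕ → PaddedPos T} {b : ℕ → X}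
    (hz : ∀ n, (z n).seq = initSeq b n) {x : infinitePlays T.tree} (hx : x.1.1 = Sum.inr b) :
    z ∈ encode A ↔ x ∈ A := by
  constructor
  · rintro ⟨y, hy, b', hb', hz'⟩
    obtain rfl : b = b' := initSeq_injective fun n => by rw [← hz, ← hz']
    rwa [show x = y from Subtype.ext (Subtype.ext (hx.trans hb'.symm))]
  · exact fun h => ⟨x, h, b, hx, hz⟩

theorem exists_play_of_isAlive {z : ℕ → PaddedPos T} (hz : (treeArena T).IsAlive z) :
    ∃ (b : ℕ → X) (x : infinitePlays T.tree), x.1.1 = Sum.inr b ∧ ∀ n, (z n).seq = initSeq b n := by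
  obtain ⟨b, hb⟩ := exists_initSeq_of_isAlive hz
  exact ⟨b, ⟨⟨Sum.inr b, isPlay_inr_iff.2 fun n => hb n ▸ (z n).mem⟩, b, rfl⟩, rfl, hb⟩

/-- Membership of an infinite play in an open set depends on finitely many moves. -/
theorem exists_initSeq_of_isOpen {T : Descriptive.tree X} {V : Set (Play T)} (hV : IsOpen V)
    {x : Play T} (hx : x ∈ V) {b : ℕ → X} (hb : x.1 = Sum.inr b) :
    ∃ n, ∀ (y : Play T) (b' : ℕ → X), y.1 = Sum.inr b' → initSeq b' n = initSeq b n → y ∈ V := by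
  induction hV with
  | basic s hs =>
    obtain ⟨p, hp, rfl⟩ := hs
    refine ⟨p.length, fun y b' hb' h => ?_⟩
    have h1 : IsPlay (subtree T p) x.1 := hx
    have hyT := y.2
    change IsPlay (subtree T p) y.1
    rw [hb', isPlay_inr_iff] at *
    rw [hb, isPlay_inr_iff] at h1
    have h2 : initSeq b p.length = p := by
      rcases (h1 p.length).2 with h2 | h2
      · exact h2.eq_of_length (by simp)
      · exact (h2.eq_of_length (by simp)).symm
    intro n
    refine ⟨hyT n, ?_⟩
    rw [← h2, ← h]
    exact (le_total n p.length).imp (initSeq_prefix b') (initSeq_prefix b')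
  | univ => exact ⟨0, fun _ _ _ _ => trivial⟩
  | inter s t _ _ ihs iht =>
    obtain ⟨m, hm⟩ := ihs hx.1
    obtain ⟨n, hn⟩ := iht hx.2
    have mono : ∀ {l b'}, l ≤ max m n → initSeq b' (max m n) = initSeq b (max m n) →
        initSeq b' l = initSeq b l := by
      intro l b' hl h
      have h1 := initSeq_prefix b' hl
      rw [h] at h1
      exact (List.prefix_of_prefix_length_le h1 (initSeq_prefix b hl) (by simp)).eq_of_length
        (by simp)
    exact ⟨max m n, fun y b' hb' h => ⟨hm y b' hb' (mono (le_max_left _ _) h),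
      hn y b' hb' (mono (le_max_right _ _) h)⟩⟩
  | sUnion S _ ih =>
    obtain ⟨s, hs, hxs⟩ := hx
    obtain ⟨n, hn⟩ := ih s hs hxs
    exact ⟨n, fun y b' hb' h => ⟨s, hs, hn y b' hb' h⟩⟩

theorem unravellable_encode {A : Set (infinitePlays T.tree)} (hA : IsBorel A) :
    (treeArena T).Unravellable (encode A) := by
  induction A, hA using MeasurableSpace.generateFrom_induction with
  | hC U hU _ =>
    obtain ⟨V, hV, rfl⟩ := isOpen_induced_iff.1 hU
    refine IsOpenOn.unravellable fun z _ hzU => ?_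
    obtain ⟨x, hx, b, hb, hz⟩ := hzU
    obtain ⟨n, hn⟩ := exists_initSeq_of_isOpen hV hx hb
    refine ⟨n, fun y hy hyz => ?_⟩
    obtain ⟨b', x', hb', hy'⟩ := exists_play_of_isAlive hy
    refine (mem_encode hy' hb').2 (hn x'.1 b' hb' ?_)
    rw [← hy', hyz, hz]
  | empty =>
    refine IsOpenOn.unravellable fun z _ hz => ?_
    obtain ⟨x, hx, -⟩ := hz
    exact hx.elim
  | compl A _ ih =>
    refine ih.compl.congr fun z hz => ?_
    obtain ⟨b, x, hb, hzb⟩ := exists_play_of_isAlive hz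
    exact (mem_encode hzb hb).trans (not_congr (mem_encode (A := A) hzb hb).symm)
  | iUnion A _ ih =>
    refine (Unravellable.iUnion ih).congr fun z hz => ?_
    obtain ⟨b, x, hb, hzb⟩ := exists_play_of_isAlive hz
    refine (mem_encode hzb hb).trans (Set.mem_iUnion.trans (Iff.trans ?_ Set.mem_iUnion.symm))
    exact exists_congr fun n => (mem_encode (A := A n) hzb hb).symm

/-- A strategy for the arena yields one for the tree, whose plays, padded if finite, are plays by
the former. -/
theorem exists_strategy (i : Player) (s : (treeArena T).Strat) : ∃ σ : Strategy T.tree i,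
    ∀ x : Play T.tree, σ.ConsistentPlay x →
      ∃ z : ℕ → PaddedPos T, (treeArena T).IsBranch z ∧ (treeArena T).FollowsFrom i s 0 z ∧
        (∀ p, x.1 = Sum.inl p → ∃ n, (z n).seq = p) ∧
        ∀ b, x.1 = Sum.inr b → ∀ n, (z n).seq = initSeq b n := by
  have move : ∀ q : MovePosition T.tree i, ∃ a : {a : X // q.1 ++ [a] ∈ T.tree},
      PaddedPos.seq (s ⟨q.1, 0, q.2.1, by simp⟩) = q.1 ++ [a.1] := by
    intro q
    obtain ⟨⟨a, ha⟩, -⟩ := isChild_of_not_isTerminal (s.isChild ⟨q.1, 0, q.2.1, by simp⟩) q.2.2.1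
    exact ⟨⟨a, ha ▸ PaddedPos.mem _⟩, ha⟩
  choose σ hσ using move
  refine ⟨σ, ?_⟩
  -- One step of a play at a position where a move is still possible.
  have step : ∀ x : Play T.tree, Strategy.ConsistentPlay σ x → ∀ (p : List X) (a : X)
      (hp : p ∈ T.tree) (ha : p ++ [a] ∈ T.tree), IsInitSeg (p ++ [a]) x.1 →
      (treeArena T).IsChild (⟨p ++ [a], 0, ha, by simp⟩ : PaddedPos T) ⟨p, 0, hp, by simp⟩ ∧
      (i.ToMove p.length →
        (⟨p ++ [a], 0, ha, by simp⟩ : PaddedPos T) = s ⟨p, 0, hp, by simp⟩) := by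
    intro x hx p a hp ha hpx
    refine ⟨⟨by simp [treeArena], PaddedPos.ext (by simp [treeArena]) rfl⟩, fun hi => ?_⟩
    have hnt := (not_isTerminal_iff hp).2 ⟨a, ha⟩
    have h1 := hx _ ha hpx ⟨p, hp, hnt, hi⟩ a List.prefix_rfl
    refine PaddedPos.ext ?_ (isChild_of_not_isTerminal (s.isChild ⟨p, 0, hp, by simp⟩) hnt).2.symm
    rw [hσ ⟨p, hp, hnt, hi⟩, ← h1]
  rintro ⟨p | b, hx⟩ hcons
  · have hmem : ∀ n, p.take n ∈ T.tree := fun n =>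
      Descriptive.Tree.mem_of_prefix (p.take_prefix n) hx.1
    have hterm : ∀ n, p.length ≤ n → IsTerminal T.tree (p.take n) := fun n hn => by
      rw [List.take_of_length_le hn]; exact hx
    let z : ℕ → PaddedPos T := fun n =>
      ⟨p.take n, n - p.length, hmem n, fun h => hterm n (by omega)⟩
    have hz : ∀ n, (treeArena T).IsChild (z (n + 1)) (z n) ∧
        (i.ToMove n → z (n + 1) = s (z n)) := by
      intro n
      rcases lt_or_ge n p.length with h | h
      · have htake : p.take (n + 1) = p.take n ++ [p[n]] := by simp
        have h1 := step _ hcons (p.take n) p[n] (hmem n) (htake ▸ hmem (n + 1))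
          (by rw [← htake]; exact p.take_prefix _)
        have e1 : z n = ⟨p.take n, 0, hmem n, by simp⟩ := PaddedPos.ext rfl (by simp [z]; omega)
        have e2 : z (n + 1) = ⟨p.take n ++ [p[n]], 0, htake ▸ hmem (n + 1), by simp⟩ :=
          PaddedPos.ext htake (by simp [z]; omega)
        rw [List.length_take_of_le h.le] at h1
        rwa [e1, e2]
      · have e : (z (n + 1)).seq = (z n).seq := by
          simp only [z]
          rw [List.take_of_length_le h, List.take_of_length_le (by omega)]
        have e' : (z (n + 1)).pad = (z n).pad + 1 := by simp only [z]; omega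
        refine ⟨⟨?_, PaddedPos.ext ?_ ?_⟩, fun _ => ?_⟩
        · change (z (n + 1)).seq.length + (z (n + 1)).pad = (z n).seq.length + (z n).pad + 1
          rw [e, e', add_assoc]
        · change (if (z (n + 1)).pad = 0 then _ else (z (n + 1)).seq) = _
          rw [if_neg (by omega), e]
        · change (z (n + 1)).pad - 1 = _
          rw [e', Nat.add_sub_cancel]
        · obtain ⟨h1, h2⟩ := isChild_of_isTerminal (s.isChild (z n)) (hterm n h)
          exact PaddedPos.ext (e.trans h1.symm) (e'.trans h2.symm)
    refine ⟨z, ⟨by simp [z, treeArena], fun n => (hz n).1⟩, fun n _ => (hz n).2, ?_, ?_⟩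
    · rintro _ ⟨⟩
      exact ⟨p.length, p.take_length⟩
    · rintro b ⟨⟩
  · have hmem : ∀ n, initSeq b n ∈ T.tree := isPlay_inr_iff.1 hx
    let z : ℕ → PaddedPos T := fun n => ⟨initSeq b n, 0, hmem n, by simp⟩
    have hz : ∀ n, (treeArena T).IsChild (z (n + 1)) (z n) ∧
        (i.ToMove n → z (n + 1) = s (z n)) := by
      intro n
      have h1 := step _ hcons (initSeq b n) (b n) (hmem n) (initSeq_succ b n ▸ hmem (n + 1))
        (isInitSeg_inr_iff.2 (by simp [initSeq_succ]))
      have e2 : z (n + 1) = ⟨initSeq b n ++ [b n], 0, initSeq_succ b n ▸ hmem (n + 1), by simp⟩ :=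
        PaddedPos.ext (initSeq_succ b n) rfl
      rw [length_initSeq] at h1
      rwa [e2]
    refine ⟨z, ⟨by simp [z, treeArena], fun n => (hz n).1⟩, fun n _ => (hz n).2, ?_, ?_⟩
    · rintro p ⟨⟩
    · rintro _ ⟨⟩ n
      rfl

theorem TabooTree.mem_payoff_iff_of_won {A : Set (infinitePlays T.tree)} {i : Player}
    {x : Play T.tree} {z : ℕ → PaddedPos T} (hz : (treeArena T).IsBranch z)
    (hfin : ∀ p, x.1 = Sum.inl p → ∃ n, (z n).seq = p)
    (hinf : ∀ b, x.1 = Sum.inr b → ∀ n, (z n).seq = initSeq b n)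
    (hwon : (treeArena T).Won (encode A) i z) : x ∈ T.payoff A ↔ i = Player.I := by
  have hunion : ∀ y : Play T.tree, y ∈ T.tabooI ∨ y ∈ T.tabooII ↔ y ∉ infinitePlays T.tree :=
    fun y => Set.ext_iff.1 T.union_eq y
  have hpay : x ∈ T.payoff A ↔
      (∃ h : x ∈ infinitePlays T.tree, (⟨x, h⟩ : infinitePlays T.tree) ∈ A) ∨ x ∈ T.tabooII := by
    simp [TabooTree.payoff]
  rw [hpay]
  have hx := x.2
  rcases hxe : x.1 with p | b <;> rw [hxe] at hx
  · obtain ⟨n, hn⟩ := hfin p hxe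
    have hnot : x ∉ infinitePlays T.tree := by
      rintro ⟨b, hb⟩
      rw [hxe] at hb
      cases hb
    have ht : IsTerminal T.tree p := hx
    have hst : (treeArena T).status (z n) = tabooStatus T p := by rw [← hn]; rfl
    rw [tabooStatus, dif_pos ht, show (⟨Sum.inl p, ht⟩ : Play T.tree) = x from
      Subtype.ext hxe.symm] at hst
    rw [or_iff_right fun ⟨h, _⟩ => hnot h]
    split_ifs at hst with h
    · have hi := hwon.eq_other_of_status hz hst
      refine iff_of_false (fun h' => Set.disjoint_left.1 T.disjoint h h') ?_
      rintro rfl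
      cases hi
    · have hi := hwon.eq_other_of_status hz hst
      refine iff_of_true (((hunion _).2 hnot).resolve_left h) ?_
      cases i
      · rfl
      · cases hi
  · have hb := hinf b hxe
    have hal : ∀ n, (treeArena T).status (z n) = none := by
      intro n
      refine tabooStatus_eq_none.2 ((not_isTerminal_iff (z n).mem).2 ⟨b n, ?_⟩)
      rw [hb, ← initSeq_succ]
      exact isPlay_inr_iff.1 hx _
    have hmem : x ∈ infinitePlays T.tree := ⟨b, hxe⟩
    rw [or_iff_left fun h => (hunion x).1 (Or.inr h) hmem]
    rcases hwon with ⟨n, hn⟩ | ⟨-, h⟩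
    · rw [hal n] at hn; cases hn
    · refine Iff.trans ?_ h
      refine Iff.trans ?_ (mem_encode (T := T) (A := A) (x := ⟨x, hmem⟩) hb hxe).symm
      exact ⟨fun ⟨_, h⟩ => h, fun h => ⟨hmem, h⟩⟩

theorem TabooTree.determined_payoff (T : TabooTree X) {A : Set (infinitePlays T.tree)}
    (hA : IsBorel A) : Determined T.tree (T.payoff A) := by
  have hnil : [] ∈ T.tree := by
    obtain ⟨p, hp⟩ := T.nonempty
    exact Descriptive.Tree.mem_of_prefix p.nil_prefix hp
  have hroot : ∀ p : PaddedPos T,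
      p.seq.length + p.pad = 0 ↔ p = (⟨[], 0, hnil, by simp⟩ : PaddedPos T) := fun p => by
    rw [PaddedPos.ext_iff, Nat.add_eq_zero_iff, List.length_eq_zero_iff]
  obtain ⟨i, s, hs⟩ := (unravellable_encode hA).determined _ hroot
  obtain ⟨σ, hσ⟩ := exists_strategy i s
  have key : ∀ x : Play T.tree, σ.ConsistentPlay x → (x ∈ T.payoff A ↔ i = Player.I) := by
    intro x hx
    obtain ⟨z, hz, hzs, hfin, hinf⟩ := hσ x hx
    exact TabooTree.mem_payoff_iff_of_won hz hfin hinf (hs z hz hzs)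
  cases i
  · exact Or.inl ⟨σ, fun x hx => (key x hx).2 rfl⟩
  · exact Or.inr ⟨σ, fun x hx h => by cases (key x hx).1 h⟩

theorem infinitePlays_eq_univ {T : Descriptive.tree X} (hT : IsPruned T) :
    infinitePlays T = Set.univ := by
  refine Set.eq_univ_of_forall ?_
  rintro ⟨p | b, hx⟩
  · exact absurd hx (hT p)
  · exact ⟨b, rfl⟩

theorem determined_of_isPruned {T : Descriptive.tree X} (hne : (T : Set (List X)).Nonempty)
    (hT : IsPruned T) {A : Set (Play T)} (hA : IsBorel A) : Determined T A := by
  have huniv := infinitePlays_eq_univ hT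
  let T' : TabooTree X := ⟨T, hne, ∅, ∅, disjoint_bot_left, by simp [huniv]⟩
  have hA' : IsBorel (Subtype.val ⁻¹' A : Set (infinitePlays T)) :=
    (continuous_subtype_val (p := (· ∈ infinitePlays T))).borel_measurable hA
  have hpay : T'.payoff (Subtype.val ⁻¹' A) = A := by
    simp [TabooTree.payoff, T', huniv]
  exact hpay ▸ T'.determined_payoff hA'

end Tree
end TabooGame

theorem mainTheorem1 (X : Type u) :
    (∀ (T : TabooGame.TabooTree X) (A : Set (TabooGame.infinitePlays T.tree)),
      TabooGame.IsBorel A → TabooGame.Determined T.tree (T.payoff A)) ∧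
    (∀ T : Descriptive.tree X, (T : Set (List X)).Nonempty → TabooGame.IsPruned T →
      ∀ A : Set (TabooGame.Play T), TabooGame.IsBorel A → TabooGame.Determined T A) :=
  ⟨fun T _ hA => T.determined_payoff hA,
    fun _ hne hT _ hA => TabooGame.determined_of_isPruned hne hT hA⟩
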